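/- A trip $T$ is a finite sequence of events $T[1],\dots,T[|T|]$; the event $T[i]$ consists of a stop $T[i]_{\mathrm{stop}}$ and of integer times $T[i]_{\mathrm{arr}}$ and $T[i]_{\mathrm{dep}}$, with $T[i]_{\mathrm{arr}}\le T[i]_{\mathrm{dep}}\le T[i+1]_{\mathrm{arr}}\le T[i+1]_{\mathrm{dep}}$ for all $1\le i<|T|$. Stops are named by natural numbers. For trips $A,B$ write $A\preceq B$ if $A$ and $B$ have the same sequence of stops and $A[i]_{\mathrm{arr}}\le B[i]_{\mathrm{arr}}$ and $A[i]_{\mathrm{dep}}\le B[i]_{\mathrm{dep}}$ for all $i$. A route is a set of trips that can be ordered as $T_1\preceq T_2\preceq\cdots$ (so no two trips of a route overtake each other). A FIFO grouping of a finite collection $\mathcal T$ of trips is a partition of $\mathcal T$ into routes (distinct trips may have the same events). Theorem. The problem "given a finite collection $\mathcal T$ of trips, find a FIFO grouping of $\mathcal T$ with the least possible number of routes" is solvable in polynomial time: there are a random access machine (unit cost, with integer addition, subtraction, comparison and indirect addressing) and a polynomial $b$ such that, for every $\mathcal T$, the machine, started on the encoding of $\mathcal T$ as a list of integers, halts within $b(N)$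 steps, where $N$ is the length of this encoding in bits, and outputs a FIFO grouping of $\mathcal T$ with the minimum number of routes, in the form of one label per trip such that two trips have the same label if and only if they are in the same route. -/

import Mathlib

/-! ### Random access machines with a step count -/

namespace RAM

/-- Structured programs of a random access machine. The machine has registers, addressed directly
by the program text, and an unbounded memory, addressed indirectly. Both hold integers. The only
arithmetic operations are addition and subtraction, so that one step lengthens the binary
representation of the numbers involved by at most one bit: with unit costs and input size measured
in bits, the model is polynomially equivalent to Turing machines. -/
inductive Prog : Type
  /-- do nothing -/
  | skip : Prog
  /-- `reg x := c` -/
  | const (x : ℕ) (c : ℤ) : Prog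
  /-- `reg x := reg y + reg z` -/
  | add (x y z : ℕ) : Prog
  /-- `reg x := reg y - reg z` -/
  | sub (x y z : ℕ) : Prog
  /-- `reg x := mem (reg y)` -/
  | load (x y : ℕ) : Prog
  /-- `mem (reg x) := reg y` -/
  | store (x y : ℕ) : Prog
  /-- first `p`, then `q` -/
  | seq (p q : Prog) : Prog
  /-- if `reg x ≤ reg y` then `p` else `q` -/
  | ifLe (x y : ℕ) (p q : Prog) : Prog
  /-- while `reg x ≤ reg y` do `p` -/
  | whileLe (x y : ℕ) (p : Prog) : Prog

/-- The contents of the registers and of the memory. -/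
structure State : Type where
  reg : ℕ → ℤ
  mem : ℤ → ℤ

namespace State

/-- Overwrite one register. -/
def setReg (s : State) (x : ℕ) (v : ℤ) : State := ⟨Function.update s.reg x v, s.mem⟩

/-- Overwrite one memory cell. -/
def setMem (s : State) (a v : ℤ) : State := ⟨s.reg, Function.update s.mem a v⟩

/-- The initial state: the input words are in the cells `0, 1, …` of the memory and their number is
in register `0`. Everything else is `0`. -/
def init (w : List ℤ) : State where
  reg := fun x => if x = 0 then (w.length : ℤ) else 0
  mem := fun a => if 0 ≤ a then w.getD a.toNat 0 else 0

/-- The output words are read off in the same way. -/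
def HasOutput (s : State) (w : List ℤ) : Prop :=
  s.reg 0 = (w.length : ℤ) ∧ ∀ (i : ℕ) (h : i < w.length), s.mem (i : ℤ) = w[i]

end State

/-- `Exec p s t s'`: started in `s`, the program `p` halts in `s'` after exactly `t` steps. Every
executed assignment and every evaluated test is one step. Execution is deterministic. -/
inductive Exec : Prog → State → ℕ → State → Prop
  | skip (s : State) : Exec .skip s 1 s
  | const (s : State) (x : ℕ) (c : ℤ) : Exec (.const x c) s 1 (s.setReg x c)
  | add (s : State) (x y z : ℕ) : Exec (.add x y z) s 1 (s.setReg x (s.reg y + s.reg z))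
  | sub (s : State) (x y z : ℕ) : Exec (.sub x y z) s 1 (s.setReg x (s.reg y - s.reg z))
  | load (s : State) (x y : ℕ) : Exec (.load x y) s 1 (s.setReg x (s.mem (s.reg y)))
  | store (s : State) (x y : ℕ) : Exec (.store x y) s 1 (s.setMem (s.reg x) (s.reg y))
  | seq {p q : Prog} {s s₁ s₂ : State} {t₁ t₂ : ℕ} :
      Exec p s t₁ s₁ → Exec q s₁ t₂ s₂ → Exec (.seq p q) s (t₁ + t₂) s₂
  | ifTrue {x y : ℕ} {p q : Prog} {s s₁ : State} {t : ℕ} :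
      s.reg x ≤ s.reg y → Exec p s t s₁ → Exec (.ifLe x y p q) s (t + 1) s₁
  | ifFalse {x y : ℕ} {p q : Prog} {s s₁ : State} {t : ℕ} :
      ¬ s.reg x ≤ s.reg y → Exec q s t s₁ → Exec (.ifLe x y p q) s (t + 1) s₁
  | whileTrue {x y : ℕ} {p : Prog} {s s₁ s₂ : State} {t₁ t₂ : ℕ} :
      s.reg x ≤ s.reg y → Exec p s t₁ s₁ → Exec (.whileLe x y p) s₁ t₂ s₂ →
        Exec (.whileLe x y p) s (t₁ + t₂ + 1) s₂
  | whileFalse {x y : ℕ} {p : Prog} {s : State} :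
      ¬ s.reg x ≤ s.reg y → Exec (.whileLe x y p) s 1 s

/-- The length in bits of a list of integers: each word contributes the length of its absolute
value in binary, and one bit for the sign. -/
def bitSize (w : List ℤ) : ℕ := (w.map fun z => z.natAbs.size + 1).sum

/-- The search problem with instances `a : α`, written down as lists of integers by `enc`, and
with acceptable answers `{w | Answer a w}` is solvable in polynomial time: a single program halts on
every instance with an acceptable answer, within a number of steps that is bounded by a fixed
polynomial in the bit length of the instance. Delivering the answer costs one step per word. -/
def PolyTimeSolvable {α : Type} (enc : α → List ℤ) (Answer : α → List ℤ → Prop) : Prop :=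
  ∃ (p : Prog) (b : Polynomial ℕ), ∀ a : α, ∃ (t : ℕ) (s : State) (w : List ℤ),
    Exec p (State.init (enc a)) t s ∧ s.HasOutput w ∧ Answer a w ∧
      t + w.length ≤ b.eval (bitSize (enc a))

end RAM

/-! ### Trips, routes and groupings -/

namespace Timetable

/-- The arrival and the departure of a vehicle at a stop. Stations are named by natural numbers,
points in time are integers. -/
structure Event : Type where
  station : ℕ
  arr : ℤ
  dep : ℤ

/-- A trip is a chronological sequence of events. -/
structure Trip : Type where
  events : List Event
  chronological : ∀ (i : ℕ) (h : i + 1 < events.length),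
    events[i].arr ≤ events[i].dep ∧ events[i].dep ≤ events[i + 1].arr ∧
      events[i + 1].arr ≤ events[i + 1].dep

/-- The stop sequence of a trip. -/
def Trip.stopSeq (A : Trip) : List ℕ := A.events.map Event.station

/-- `A` is earlier than `B`: they have the same stop sequence, and at every stop `A` neither
arrives nor departs later than `B`. -/
def Trip.Earlier (A B : Trip) : Prop :=
  A.stopSeq = B.stopSeq ∧
    ∀ (i : ℕ) (hA : i < A.events.length) (hB : i < B.events.length),
      A.events[i].arr ≤ B.events[i].arr ∧ A.events[i].dep ≤ B.events[i].dep

/- The given trips are a list `T`, and a trip is identified with its position in the list, so that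
two vehicles with the same events are still two trips. -/

/-- A set of trips is a route if its elements can be ordered such that each one is earlier than
the next one. -/
def IsRoute (T : List Trip) (R : Finset (Fin T.length)) : Prop :=
  ∃ l : List (Fin T.length), l.Nodup ∧ l.toFinset = R ∧
    l.IsChain fun i j => (T.get i).Earlier (T.get j)

/-- A FIFO grouping is a partition of the trips into routes. -/
def IsFIFOGrouping (T : List Trip) (G : Finpartition (Finset.univ : Finset (Fin T.length))) :
    Prop :=
  ∀ R ∈ G.parts, IsRoute T R

/-- A FIFO grouping with the least possible number of routes. -/
def IsMinimumFIFOGrouping (T : List Trip)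
    (G : Finpartition (Finset.univ : Finset (Fin T.length))) : Prop :=
  IsFIFOGrouping T G ∧
    ∀ G' : Finpartition (Finset.univ : Finset (Fin T.length)),
      IsFIFOGrouping T G' → G.parts.card ≤ G'.parts.card

/-- The input: the number of trips, then each trip as the number of its events followed by stop,
arrival and departure of each event. -/
def encodeTrips (T : List Trip) : List ℤ :=
  (T.length : ℤ) :: T.flatMap fun A =>
    (A.events.length : ℤ) :: A.events.flatMap fun e => [(e.station : ℤ), e.arr, e.dep]

/-- The output: one label for each trip, where two trips have the same label if and only if they
belong to the same route. -/
def Represents (T : List Trip) (w : List ℤ)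
    (G : Finpartition (Finset.univ : Finset (Fin T.length))) : Prop :=
  ∃ h : w.length = T.length, ∀ i j : Fin T.length,
    w.get (i.cast h.symm) = w.get (j.cast h.symm) ↔ ∃ R ∈ G.parts, i ∈ R ∧ j ∈ R

/-- Acceptable answers to the problem of finding a minimum FIFO grouping. -/
def IsOptimalAnswer (T : List Trip) (w : List ℤ) : Prop :=
  ∃ G : Finpartition (Finset.univ : Finset (Fin T.length)),
    IsMinimumFIFOGrouping T G ∧ Represents T w G

end Timetable

/-! Breaking ties of `Trip.Earlier` by the index gives a strict order `Precedes` on the n trips.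
Routes are exactly its chains (`isRoute_of_comparable`, `IsRoute.comparable`), so the task is a
minimum chain decomposition, and an antichain with as many elements as there are chains certifies
optimality.

A decomposition assigns to each trip at most one owner, its immediate predecessor in the chain, such
that nobody owns two trips; the unowned trips are the heads of the chains. What is sought is
therefore a maximum matching of trips with successors, and an auction finds it. A trip that owns
nothing buys a cheapest successor, raises its price by one and evicts the previous owner; it gives
up once all its successors cost at least n + 1. `Auction` collects the invariants, and `Auction.bid`
and `Auction.giveUp` preserve them. At the end the n prices miss some level l among 1, ..., n + 1.
The trips dearer than l, together with the owners of the cheaper ones, meet every related pair, and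
the complement is an antichain at least as large as the set of unowned trips
(`Auction.exists_antichain`). `Auction.isOptimalAnswer` draws the conclusion.

Every purchase raises the sum of the prices, which never exceeds n(n + 1), so there are polynomially
many bids (`Auction.sum_le`, `runs_bids`). Each bid is one scan over the trips with word-by-word
comparisons. The calculus of `Runs` proves correctness and time bounds together. -/

namespace Timetable

/-! ### Auctions for chain decompositions of a strict order -/

section Auction

variable {α : Type*} [Fintype α] (r : α → α → Prop)

/-- The state of an auction in which every `i ∈ D` bids for a successor in the strict order `r`.
Each `j` has at most one owner, a predecessor of `j`, and the price of `j` is the number of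
times it was sold. An owner never pays much more than the cheapest successor costs, and only those
elements of `D` own nothing whose successors are all expensive. -/
structure Auction (own : α → Option α) (price : α → ℕ) (D : Set α) : Prop where
  rel : ∀ j i, own j = some i → r i j
  pos : ∀ j i, own j = some i → 0 < price j
  near : ∀ j i, own j = some i → ∀ k, r i k → price j ≤ price k + 1
  free : ∀ j, own j = none → price j = 0
  inj : ∀ j k i, own j = some i → own k = some i → j = k
  le : ∀ j, price j ≤ Fintype.card α + 1
  done : ∀ i ∈ D, (∃ j, own j = some i) ∨ ∀ k, r i k → Fintype.card α + 1 ≤ price k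

variable {r} {own : α → Option α} {price : α → ℕ} {D : Set α}

theorem Auction.initial : Auction r (fun _ => none) (fun _ => 0) ∅ where
  rel := by simp
  pos := by simp
  near := by simp
  free := by simp
  inj := by simp
  le := by simp
  done := by simp

theorem Auction.giveUp (h : Auction r own price D) (i : α)
    (hi : ∀ k, r i k → Fintype.card α + 1 ≤ price k) : Auction r own price (insert i D) where
  rel := h.rel
  pos := h.pos
  near := h.near
  free := h.free
  inj := h.inj
  le := h.le
  done := by
    rintro i' (rfl | hi')
    · exact Or.inr hi
    · exact h.done i' hi'

/-- Prices only rise, so the bounds for other owners and the reasons for having given up persist.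
The new owner satisfies `near` because it chose a cheapest successor, and `inj` because it owned
nothing. Only the evicted owner has to bid again, so it leaves `D`. -/
theorem Auction.bid [DecidableEq α] (h : Auction r own price D) (i j : α)
    (hi : ∀ k, own k ≠ some i) (hij : r i j) (hj : price j ≤ Fintype.card α)
    (hmin : ∀ k, r i k → price j ≤ price k) :
    Auction r (Function.update own j (some i)) (Function.update price j (price j + 1))
      {k | (k = i ∨ k ∈ D) ∧ own j ≠ some k} := by
  have hmono : ∀ k, price k ≤ Function.update price j (price j + 1) k := by
    intro k
    by_cases hk : k = j
    · subst hk; simp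
    · simp [hk]
  refine ⟨?_, ?_, ?_, ?_, ?_, ?_, ?_⟩
  · intro k i' hk
    by_cases hkj : k = j
    · subst hkj; simp at hk; subst hk; exact hij
    · simp [hkj] at hk; exact h.rel k i' hk
  · intro k i' hk
    by_cases hkj : k = j
    · subst hkj; simp
    · simp [hkj] at hk ⊢; exact h.pos k i' hk
  · intro k i' hk l hl
    refine le_trans ?_ (Nat.add_le_add_right (hmono l) 1)
    by_cases hkj : k = j
    · subst hkj; simp at hk ⊢; subst hk; exact hmin l hl
    · simp [hkj] at hk ⊢; exact h.near k i' hk l hl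
  · intro k hk
    by_cases hkj : k = j
    · subst hkj; simp at hk
    · simp [hkj] at hk ⊢; exact h.free k hk
  · intro k l i' hk hl
    by_cases hkj : k = j <;> by_cases hlj : l = j
    · rw [hkj, hlj]
    · subst hkj; simp [hlj] at hk hl; subst hk; exact absurd hl (hi l)
    · subst hlj; simp [hkj] at hk hl; subst hl; exact absurd hk (hi k)
    · simp [hkj, hlj] at hk hl; exact h.inj k l i' hk hl
  · intro k
    by_cases hkj : k = j
    · subst hkj; simpa using hj
    · simp [hkj, h.le k]
  · rintro i' ⟨hi', hne⟩
    by_cases hii : i' = i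
    · subst hii; exact Or.inl ⟨j, by simp⟩
    · rcases h.done i' (hi'.resolve_left hii) with ⟨k, hk⟩ | hk
      · refine Or.inl ⟨k, ?_⟩
        have : k ≠ j := by rintro rfl; exact hne hk
        simp [this, hk]
      · exact Or.inr fun k hr => (hk k hr).trans (hmono k)

theorem Auction.mono (h : Auction r own price D) {D' : Set α} (hD : D' ⊆ D) :
    Auction r own price D' :=
  ⟨h.rel, h.pos, h.near, h.free, h.inj, h.le, fun i hi => h.done i (hD hi)⟩

/-- When everybody has bid, there is an antichain that has as many elements as there are elements
without owner: some price `l` does not occur, and the more expensive elements together with the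
owners of the less expensive ones meet all pairs of related elements. -/
theorem Auction.exists_antichain [DecidableEq α] (h : Auction r own price Set.univ) :
    ∃ A : Finset α, (∀ u ∈ A, ∀ v ∈ A, ¬ r u v) ∧
      (Finset.univ.filter fun j => own j = none).card ≤ A.card := by
  classical
  -- Pigeonhole: the prices take at most n values and there are n + 1 levels.
  obtain ⟨l, hl, hne⟩ : ∃ l ∈ Finset.Icc 1 (Fintype.card α + 1), ∀ j, price j ≠ l := by
    by_contra! hcon
    have hsub : Finset.Icc 1 (Fintype.card α + 1) ⊆ Finset.univ.image price := by
      intro l hl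
      obtain ⟨j, hj⟩ := hcon l hl
      exact Finset.mem_image.2 ⟨j, Finset.mem_univ _, hj⟩
    have := (Finset.card_le_card hsub).trans Finset.card_image_le
    simp at this
  rw [Finset.mem_Icc] at hl
  let S : Finset α := Finset.univ.filter fun j => l < price j
  let M : Finset α := Finset.univ.filter fun j => ¬ l < price j ∧ own j ≠ none
  -- The default is never used, since the elements of `M` are owned.
  let K : Finset α := M.image fun j => (own j).getD j
  refine ⟨(S ∪ K)ᶜ, ?_, ?_⟩
  · intro u hu v hv huv
    simp only [Finset.mem_compl, Finset.mem_union, not_or] at hu hv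
    apply hv.1
    -- If `u` owns `j`, then `j` costs more than `l`, as `u` is not in `K`, and `near` loses at most
    -- one. If `u` gave up, its successors cost at least n + 1. As `l` is not a price, the
    -- inequality is then strict.
    have hlv : l ≤ price v := by
      rcases h.done u (Set.mem_univ u) with ⟨j, hj⟩ | hj
      · have hlj : l < price j := by
          by_contra hlj
          exact hu.2 (Finset.mem_image.2 ⟨j, by simpa [M, hj] using hlj, by simp [hj]⟩)
        have := h.near j u hj v huv
        omega
      · have := hj v huv
        omega
    have := hne v
    simp only [S, Finset.mem_filter, Finset.mem_univ, true_and]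
    omega
  -- Unowned elements cost 0 < `l`, so `S` and `M` are disjoint sets of owned elements. Hence `S ∪
  -- K` has at most as many elements as are owned.
  · have hSM : Disjoint S M := by
      rw [Finset.disjoint_left]
      intro j hj hj'
      simp only [S, M, Finset.mem_filter] at hj hj'
      exact hj'.2.1 hj.2
    have hsub : S ∪ M ⊆ (Finset.univ.filter fun j => own j = none)ᶜ := by
      intro j hj
      simp only [S, M, Finset.mem_union, Finset.mem_filter, Finset.mem_univ, true_and] at hj
      simp only [Finset.mem_compl, Finset.mem_filter, Finset.mem_univ, true_and]
      rcases hj with hj | hj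
      · intro hn
        have := h.free j hn
        omega
      · exact hj.2
    have h1 := Finset.card_le_card hsub
    rw [Finset.card_union_of_disjoint hSM, Finset.card_compl] at h1
    have h2 : K.card ≤ M.card := Finset.card_image_le
    have h3 := Finset.card_union_le S K
    have h4 := Finset.card_le_univ (Finset.univ.filter fun j => own j = none)
    rw [Finset.card_compl]
    omega

/-! ### Chains formed by the owners -/

/-- The number of elements below `i`. -/
noncomputable def height (r : α → α → Prop) (i : α) : ℕ := by
  classical exact (Finset.univ.filter fun k => r k i).card

/-- By transitivity everything below `i` is below `j`, and `i` itself is new. This makes the height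
a termination measure for following owners and a sorting key for routes. -/
theorem height_lt [IsStrictOrder α r] {i j : α} (hij : r i j) : height r i < height r j := by
  classical
  unfold height
  apply Finset.card_lt_card
  rw [Finset.ssubset_iff_of_subset]
  · exact ⟨i, by simpa using hij, by simpa using irrefl i⟩
  · intro k hk
    simp only [Finset.mem_filter, Finset.mem_univ, true_and] at hk ⊢
    exact _root_.trans hk hij

theorem height_le (i : α) : height r i ≤ Fintype.card α := by
  classical
  exact Finset.card_le_univ _

/-- The first element of the chain that is obtained by following the owners. -/
noncomputable def root {α : Type*} [Fintype α] {r : α → α → Prop} [IsStrictOrder α r]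
    (own : α → Option α)
    (h : ∀ j i, own j = some i → r i j) (j : α) : α :=
  match _hj : own j with
  | none => j
  | some i => root own h i
termination_by height r j
decreasing_by exact height_lt (h j i _hj)

section Root

variable [IsStrictOrder α r] {h : ∀ j i, own j = some i → r i j}

theorem root_of_none {j : α} (hj : own j = none) : root own h j = j := by
  rw [root]; split <;> simp_all

theorem root_of_some {j i : α} (hj : own j = some i) : root own h j = root own h i := by
  rw [root]
  split
  · simp_all
  · rename_i i' hi'
    rw [hj] at hi'
    cases hi'
    rfl

theorem own_root (j : α) : own (root own h j) = none := by
  induction hk : height r j using Nat.strong_induction_on generalizing j with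
  | _ k ih =>
    cases hj : own j with
    | none => rw [root_of_none hj, hj]
    | some i => rw [root_of_some hj]; exact ih _ (hk ▸ height_lt (h j i hj)) i rfl

theorem reflTransGen_root (j : α) :
    Relation.ReflTransGen (fun i j => own j = some i) (root own h j) j := by
  induction hk : height r j using Nat.strong_induction_on generalizing j with
  | _ k ih =>
    cases hj : own j with
    | none => rw [root_of_none hj]
    | some i => rw [root_of_some hj]; exact (ih _ (hk ▸ height_lt (h j i hj)) i rfl).tail hj

/-- Two elements of the same chain are related. -/
theorem comparable_of_root_eq (hinj : ∀ j k i, own j = some i → own k = some i → j = k)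
    {j k : α} (hjk : root own h j = root own h k) (hne : j ≠ k) : r j k ∨ r k j := by
  have hlt : ∀ {a b}, Relation.ReflTransGen (fun i j => own j = some i) a b → a ≠ b → r a b := by
    intro a b hab
    induction hab with
    | refl => simp
    | @tail b c _ hbc ih =>
      intro _
      by_cases hb : a = b
      · rw [hb]; exact h c b hbc
      · exact _root_.trans (ih hb) (h c b hbc)
  have hk := reflTransGen_root (h := h) k
  rw [← hjk] at hk
  -- Nobody owns two elements, so the path upwards from the common root does not branch and one of
  -- the two elements lies on the path to the other.
  rcases Relation.ReflTransGen.total_of_right_unique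
    (fun i j k hj hk => hinj j k i hj hk) (reflTransGen_root (h := h) j) hk with h1 | h1
  · exact Or.inl (hlt h1 hne)
  · exact Or.inr (hlt h1 hne.symm)

end Root

end Auction

/-! ### The order of the trips -/

theorem Trip.Earlier.trans {A B C : Trip} (h₁ : A.Earlier B) (h₂ : B.Earlier C) :
    A.Earlier C := by
  refine ⟨h₁.1.trans h₂.1, fun i hA hC => ?_⟩
  have hB : i < B.events.length := by
    have := congrArg List.length h₁.1
    simp only [Trip.stopSeq, List.length_map] at this
    omega
  exact ⟨(h₁.2 i hA hB).1.trans (h₂.2 i hB hC).1, (h₁.2 i hA hB).2.trans (h₂.2 i hB hC).2⟩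

/-- Trips are ordered by `Trip.Earlier`, and trips with the same events by their indices. -/
def Precedes (T : List Trip) (i j : Fin T.length) : Prop :=
  (T.get i).Earlier (T.get j) ∧ ((T.get j).Earlier (T.get i) → i < j)

/-- For transitivity: if the last trip is also earlier than the first, the three are earlier than
each other in both directions, so both index comparisons apply. -/
instance (T : List Trip) : IsStrictOrder (Fin T.length) (Precedes T) where
  irrefl i h := lt_irrefl i (h.2 h.1)
  trans _ _ _ h₁ h₂ := ⟨h₁.1.trans h₂.1, fun h =>
    (h₁.2 (h₂.1.trans h)).trans (h₂.2 (h.trans h₁.1))⟩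

theorem precedes_or_precedes {T : List Trip} {i j : Fin T.length} (hij : i ≠ j)
    (h : (T.get i).Earlier (T.get j)) : Precedes T i j ∨ Precedes T j i := by
  by_cases h' : (T.get j).Earlier (T.get i)
  · rcases lt_or_gt_of_ne hij with hlt | hlt
    · exact Or.inl ⟨h, fun _ => hlt⟩
    · exact Or.inr ⟨h', fun _ => hlt⟩
  · exact Or.inl ⟨h, fun h'' => absurd h'' h'⟩

/-- Sorting by height works: on comparable trips it agrees with the order, by `height_lt`. -/
theorem isRoute_of_comparable {T : List Trip} {R : Finset (Fin T.length)}
    (hR : ∀ i ∈ R, ∀ j ∈ R, i ≠ j → Precedes T i j ∨ Precedes T j i) : IsRoute T R := by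
  classical
  let le : Fin T.length → Fin T.length → Prop :=
    fun i j => height (Precedes T) i ≤ height (Precedes T) j
  have : Std.Total le := ⟨fun i j => le_total _ _⟩
  have : IsTrans _ le := ⟨fun i j k h₁ h₂ => le_trans (α := ℕ) h₁ h₂⟩
  have hperm := List.perm_insertionSort le R.toList
  have hsort := List.pairwise_insertionSort le R.toList
  have hnodup := hperm.nodup_iff.2 R.nodup_toList
  have hmem : ∀ i, i ∈ List.insertionSort le R.toList ↔ i ∈ R := by
    intro i; rw [hperm.mem_iff, Finset.mem_toList]
  refine ⟨List.insertionSort le R.toList, hnodup, ?_, ?_⟩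
  · ext i
    rw [List.mem_toFinset, hmem]
  · apply List.Pairwise.isChain
    refine ((hsort.and hnodup).imp_of_mem ?_)
    rintro i j hi hj ⟨hij, hne⟩
    rcases hR i ((hmem i).1 hi) j ((hmem j).1 hj) hne with h | h
    · exact h.1
    · exact absurd (height_lt h) (not_lt.2 hij)

/-- Transitivity extends the relation from neighbours in the list to all pairs; symmetrizing it
removes the dependence on their positions. -/
theorem IsRoute.comparable {T : List Trip} {R : Finset (Fin T.length)} (hR : IsRoute T R)
    {i j : Fin T.length} (hi : i ∈ R) (hj : j ∈ R) (hij : i ≠ j) :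
    Precedes T i j ∨ Precedes T j i := by
  obtain ⟨l, -, rfl, hl⟩ := hR
  rw [List.mem_toFinset] at hi hj
  have : IsTrans (Fin T.length) fun i j => (T.get i).Earlier (T.get j) :=
    ⟨fun _ _ _ h₁ h₂ => h₁.trans h₂⟩
  have hp := List.isChain_iff_pairwise.1 hl
  have hp' : l.Pairwise fun i j =>
      (T.get i).Earlier (T.get j) ∨ (T.get j).Earlier (T.get i) := hp.imp Or.inl
  have : Std.Symm fun i j : Fin T.length =>
      (T.get i).Earlier (T.get j) ∨ (T.get j).Earlier (T.get i) := ⟨fun _ _ h => h.symm⟩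
  rcases hp'.forall hi hj hij with h | h
  · exact precedes_or_precedes hij h
  · exact (precedes_or_precedes hij.symm h).symm

/-- The chains that the owners form at the end of an auction are a minimum FIFO grouping. -/
theorem Auction.isOptimalAnswer {T : List Trip} {own : Fin T.length → Option (Fin T.length)}
    {price : Fin T.length → ℕ} (h : Auction (Precedes T) own price Set.univ) {w : List ℤ}
    (hw : w.length = T.length) {label : Fin T.length → ℤ} (hlabel : label.Injective)
    (hroot : ∀ i : Fin T.length, w.get (i.cast hw.symm) = label (root own h.rel i)) :
    IsOptimalAnswer T w := by
  classical
  let ρ := root own h.rel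
  let G : Finpartition (Finset.univ : Finset (Fin T.length)) :=
    Finpartition.ofSetoid (Setoid.ker ρ)
  have hG : ∀ R, R ∈ G.parts ↔ ∃ i, R = Finset.univ.filter fun j => ρ i = ρ j := by
    intro R
    simp only [G, Finpartition.ofSetoid, Finpartition.ofSetSetoid, Finset.mem_image,
      Finset.mem_univ, true_and, Setoid.ker_def, eq_comm (a := R)]
  refine ⟨G, ⟨?_, ?_⟩, hw, ?_⟩
  · intro R hR
    obtain ⟨i, rfl⟩ := (hG R).1 hR
    refine isRoute_of_comparable fun j hj k hk hjk => ?_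
    simp only [Finset.mem_filter, Finset.mem_univ, true_and] at hj hk
    exact comparable_of_root_eq h.inj (hj.symm.trans hk) hjk
  · intro G' hG'
    obtain ⟨A, hA, hcard⟩ := h.exists_antichain
    -- A part is determined by its root, which is unowned, so there are at most as many parts as
    -- unowned trips.
    have h1 : G.parts ⊆ (Finset.univ.filter fun j => own j = none).image
        fun i => Finset.univ.filter fun j => i = ρ j := by
      intro R hR
      obtain ⟨i, rfl⟩ := (hG R).1 hR
      exact Finset.mem_image.2 ⟨ρ i, by simpa using own_root i, rfl⟩
    -- Weak duality: no route contains two elements of an antichain.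
    have h2 : A.card ≤ G'.parts.card := by
      apply Finset.card_le_card_of_injOn G'.part
      · intro i _
        exact G'.part_mem.2 (Finset.mem_univ i)
      · intro i hi j hj hij
        by_contra hne
        have hj' : j ∈ G'.part i := by
          change G'.part i = G'.part j at hij
          rw [hij]; exact G'.mem_part (Finset.mem_univ j)
        rcases (hG' _ (G'.part_mem.2 (Finset.mem_univ i))).comparable
          (G'.mem_part (Finset.mem_univ i)) hj' hne with h3 | h3
        · exact hA i hi j hj h3
        · exact hA j hj i hi h3
    exact ((Finset.card_le_card h1).trans Finset.card_image_le).trans (hcard.trans h2)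
  · intro i j
    rw [hroot, hroot, hlabel.eq_iff]
    constructor
    · intro hij
      exact ⟨_, (hG _).2 ⟨i, rfl⟩, by simp, by simpa [ρ] using hij⟩
    · rintro ⟨R, hR, hi, hj⟩
      obtain ⟨k, rfl⟩ := (hG R).1 hR
      simp only [Finset.mem_filter, Finset.mem_univ, true_and] at hi hj
      exact hi.symm.trans hj

/-! ### Random access to the encoded trips -/

/-- The words that encode an event. -/
def eventWords (e : Event) : List ℤ := [(e.station : ℤ), e.arr, e.dep]

/-- The words that encode a trip. -/
def tripWords (A : Trip) : List ℤ := (A.events.length : ℤ) :: A.events.flatMap eventWords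

theorem encodeTrips_eq (T : List Trip) : encodeTrips T = (T.length : ℤ) :: T.flatMap tripWords :=
  rfl

/-- The address of the first word of the `i`-th trip. -/
def pos (T : List Trip) (i : ℕ) : ℕ := ((T.take i).flatMap tripWords).length + 1

theorem length_flatMap_eventWords (l : List Event) :
    (l.flatMap eventWords).length = 3 * l.length := by
  induction l with
  | nil => rfl
  | cons e l ih => simp [ih, eventWords]; omega

theorem length_tripWords (A : Trip) : (tripWords A).length = 3 * A.events.length + 1 := by
  rw [tripWords, List.length_cons, length_flatMap_eventWords]

theorem pos_zero (T : List Trip) : pos T 0 = 1 := by simp [pos]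

theorem pos_succ (T : List Trip) (i : ℕ) (h : i < T.length) :
    pos T (i + 1) = pos T i + 3 * T[i].events.length + 1 := by
  simp only [pos, List.take_add_one, List.getElem?_eq_getElem h, List.flatMap_append,
    List.length_append, Option.toList_some, List.flatMap_cons, List.flatMap_nil,
    List.append_nil, length_tripWords]
  omega

theorem pos_length (T : List Trip) : pos T T.length = (encodeTrips T).length := by
  simp [pos, encodeTrips_eq]

/-- Even a trip without events occupies a word. Addresses can therefore stand for indices, both in
the tie-break and as labels. -/
theorem pos_lt_pos {T : List Trip} {i j : ℕ} (hij : i < j) (hj : j ≤ T.length) :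
    pos T i < pos T j := by
  induction j, hij using Nat.le_induction with
  | base => rw [pos_succ T i (by omega)]; omega
  | succ j hij ih => have := ih (by omega); rw [pos_succ T j (by omega)]; omega

theorem pos_le_pos {T : List Trip} {i j : ℕ} (hij : i ≤ j) (hj : j ≤ T.length) :
    pos T i ≤ pos T j := by
  rcases hij.eq_or_lt with rfl | h
  · exact le_rfl
  · exact (pos_lt_pos h hj).le

/-- This allows the labels to overwrite the input: label `i` goes to cell `i`, which lies before the
`i`-th trip. -/
theorem lt_pos {T : List Trip} {i : ℕ} (hi : i ≤ T.length) : i < pos T i := by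
  induction i with
  | zero => simp [pos_zero]
  | succ i ih => have := ih (by omega); rw [pos_succ T i (by omega)]; omega

theorem one_le_pos (T : List Trip) (i : ℕ) : 1 ≤ pos T i := by simp [pos]

theorem length_le (T : List Trip) : T.length < (encodeTrips T).length :=
  pos_length T ▸ lt_pos le_rfl

/-- The word at an address of the input. -/
def word (T : List Trip) (a : ℤ) : ℤ := (RAM.State.init (encodeTrips T)).mem a

theorem word_natCast (T : List Trip) (k : ℕ) : word T k = (encodeTrips T).getD k 0 := by
  simp [word, RAM.State.init]

theorem word_zero (T : List Trip) : word T 0 = T.length := by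
  simpa [encodeTrips_eq] using word_natCast T 0

theorem word_pos_add (T : List Trip) (i k : ℕ) (h : i < T.length)
    (hk : k < 3 * T[i].events.length + 1) :
    word T (pos T i + k : ℕ) = (tripWords T[i]).getD k 0 := by
  have hT : encodeTrips T = ((T.length : ℤ) :: (T.take i).flatMap tripWords) ++
      (tripWords T[i] ++ (T.drop (i + 1)).flatMap tripWords) := by
    rw [encodeTrips_eq, List.cons_append, ← List.flatMap_cons, ← List.flatMap_append,
      ← List.drop_eq_getElem_cons h, List.take_append_drop]
  rw [word_natCast, hT, List.getD_append_right _ _ _ _ (by simp [pos]),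
    List.getD_append _ _ _ _ (by simp [length_tripWords, pos]; omega)]
  congr 1
  simp [pos]

theorem word_pos (T : List Trip) (i : ℕ) (h : i < T.length) :
    word T (pos T i) = T[i].events.length := by
  simpa [tripWords] using word_pos_add T i 0 h (by omega)

theorem getD_flatMap_eventWords (l : List Event) (k : ℕ) (h : k < l.length) :
    (l.flatMap eventWords).getD (3 * k) 0 = l[k].station ∧
    (l.flatMap eventWords).getD (3 * k + 1) 0 = l[k].arr ∧
    (l.flatMap eventWords).getD (3 * k + 2) 0 = l[k].dep := by
  induction l generalizing k with
  | nil => simp at h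
  | cons e l ih =>
    cases k with
    | zero => simp [eventWords]
    | succ k =>
      have := ih k (by simpa using h)
      simpa [eventWords, Nat.mul_succ, add_right_comm] using this

theorem word_event (T : List Trip) (i k : ℕ) (h : i < T.length) (hk : k < T[i].events.length) :
    word T (pos T i + (3 * k + 1)) = T[i].events[k].station ∧
    word T (pos T i + (3 * k + 2)) = T[i].events[k].arr ∧
    word T (pos T i + (3 * k + 3)) = T[i].events[k].dep := by
  have := getD_flatMap_eventWords T[i].events k hk
  refine ⟨?_, ?_, ?_⟩
  · have h1 := word_pos_add T i (3 * k + 1) h (by omega)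
    push_cast at h1
    rw [h1, ← this.1]; simp [tripWords]
  · have h1 := word_pos_add T i (3 * k + 2) h (by omega)
    push_cast at h1
    rw [h1, ← this.2.1]; simp [tripWords]
  · have h1 := word_pos_add T i (3 * k + 3) h (by omega)
    push_cast at h1
    rw [h1, ← this.2.2]; simp [tripWords]

/-- What has to be checked in order to see that one trip is earlier than another. -/
theorem earlier_iff (A B : Trip) : A.Earlier B ↔ A.events.length = B.events.length ∧
    ∀ (k : ℕ) (hA : k < A.events.length) (hB : k < B.events.length),
      A.events[k].station = B.events[k].station ∧ A.events[k].arr ≤ B.events[k].arr ∧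
        A.events[k].dep ≤ B.events[k].dep := by
  constructor
  · rintro ⟨h1, h2⟩
    refine ⟨by simpa [Trip.stopSeq] using congrArg List.length h1, fun k hA hB => ⟨?_, h2 k hA hB⟩⟩
    have h3 : k < A.stopSeq.length := by simpa [Trip.stopSeq] using hA
    simpa [Trip.stopSeq] using List.getElem_of_eq h1 h3
  · rintro ⟨h1, h2⟩
    refine ⟨List.ext_getElem (by simpa [Trip.stopSeq] using h1) fun k hA hB => ?_,
      fun k hA hB => (h2 k hA hB).2⟩
    simp only [Trip.stopSeq, List.length_map] at hA hB
    simpa [Trip.stopSeq] using (h2 k hA hB).1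

/-- Two given trips can be compared word by word. -/
theorem earlier_get_iff (T : List Trip) (i j : Fin T.length) :
    (T.get i).Earlier (T.get j) ↔ (T.get i).events.length = (T.get j).events.length ∧
      ∀ k < (T.get i).events.length,
        word T (pos T i + (3 * k + 1)) = word T (pos T j + (3 * k + 1)) ∧
        word T (pos T i + (3 * k + 2)) ≤ word T (pos T j + (3 * k + 2)) ∧
        word T (pos T i + (3 * k + 3)) ≤ word T (pos T j + (3 * k + 3)) := by
  rw [earlier_iff]
  refine and_congr_right fun hlen => forall_congr' fun k => ?_
  refine forall_congr' fun hk => ?_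
  have hk' := hk
  rw [hlen] at hk'
  obtain ⟨h1, h2, h3⟩ := word_event T i k i.2 hk
  obtain ⟨h4, h5, h6⟩ := word_event T j k j.2 hk'
  rw [h1, h2, h3, h4, h5, h6]
  simp only [List.get_eq_getElem] at hk' ⊢
  simp [hk']

end Timetable

namespace RAM

/-! ### Total correctness with time bounds -/

/-- Started in `s`, the program `p` halts within `T` steps in a state that satisfies `Q`. -/
def Runs (p : Prog) (s : State) (T : ℕ) (Q : State → Prop) : Prop :=
  ∃ t s', Exec p s t s' ∧ t ≤ T ∧ Q s'

variable {p q : Prog} {s : State} {T T' C : ℕ} {Q Q' : State → Prop} {x y z : ℕ}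

theorem Runs.mono (h : Runs p s T Q) (hT : T ≤ T') (hQ : ∀ s', Q s' → Q' s') :
    Runs p s T' Q' := by
  obtain ⟨t, s', h1, h2, h3⟩ := h
  exact ⟨t, s', h1, h2.trans hT, hQ s' h3⟩

theorem Runs.skip (h : Q s) : Runs .skip s (T + 1) Q :=
  ⟨1, s, .skip s, by omega, h⟩

theorem Runs.const {c : ℤ} (h : Q (s.setReg x c)) : Runs (.const x c) s (T + 1) Q :=
  ⟨1, _, .const s x c, by omega, h⟩

theorem Runs.ifLe (h : s.reg x ≤ s.reg y → Runs p s T Q) (h' : s.reg y < s.reg x → Runs q s T Q) :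
    Runs (.ifLe x y p q) s (T + 1) Q := by
  by_cases hxy : s.reg x ≤ s.reg y
  · obtain ⟨t, s', h1, h2, h3⟩ := h hxy
    exact ⟨_, s', .ifTrue hxy h1, by omega, h3⟩
  · obtain ⟨t, s', h1, h2, h3⟩ := h' (not_le.1 hxy)
    exact ⟨_, s', .ifFalse hxy h1, by omega, h3⟩

/-- A loop with an invariant `I`, whose first argument bounds the number of iterations left. -/
theorem Runs.whileLe (I : ℕ → State → Prop) (C : ℕ)
    (hstep : ∀ k s, I k s → s.reg x ≤ s.reg y → Runs p s C fun s' => ∃ k' < k, I k' s')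
    (hexit : ∀ k s, I k s → s.reg y < s.reg x → Q s) {k K : ℕ} (hk : k ≤ K) (hI : I k s) :
    Runs (.whileLe x y p) s (K * (C + 1) + 1) Q := by
  -- Each iteration pays for the body and one test; the final 1 is the failing test.
  suffices h : Runs (.whileLe x y p) s (k * (C + 1) + 1) Q from
    h.mono (Nat.add_le_add_right (Nat.mul_le_mul_right _ hk) 1) fun _ h => h
  clear hk
  induction k using Nat.strong_induction_on generalizing s with
  | _ k ih =>
    by_cases hxy : s.reg x ≤ s.reg y
    · obtain ⟨t, s', h1, h2, k', hk', h3⟩ := hstep k s hI hxy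
      obtain ⟨t', s'', h4, h5, h6⟩ := ih k' hk' h3
      refine ⟨_, s'', .whileTrue hxy h1 h4, ?_, h6⟩
      have := Nat.mul_le_mul_right (C + 1) (Nat.succ_le_of_lt hk')
      rw [Nat.succ_mul] at this
      omega
    · exact ⟨1, s, .whileFalse hxy, by omega, hexit k s hI (not_le.1 hxy)⟩

@[simp] theorem State.reg_setReg (s : State) (x y : ℕ) (v : ℤ) :
    (s.setReg x v).reg y = if y = x then v else s.reg y := by
  simp [State.setReg, Function.update_apply]

@[simp] theorem State.mem_setReg (s : State) (x : ℕ) (v : ℤ) : (s.setReg x v).mem = s.mem := rfl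

@[simp] theorem State.reg_setMem (s : State) (a v : ℤ) : (s.setMem a v).reg = s.reg := rfl

@[simp] theorem State.mem_setMem (s : State) (a v b : ℤ) :
    (s.setMem a v).mem b = if b = a then v else s.mem b := by
  simp [State.setMem, Function.update_apply]

/-- Run several programs one after the other. -/
def block : List Prog → Prog
  | [] => .skip
  | p :: l => .seq p (block l)

/-- Set `reg z` to `0` unless `reg x ≤ reg y`. -/
def require (x y z : ℕ) : Prog := .ifLe x y .skip (.const z 0)

section Block

variable {l : List Prog}

theorem Runs.block_nil (h : Q s) : Runs (block []) s (T + 1) Q := .skip h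

theorem Runs.block_cons (h : Runs p s T fun s' => Runs (block l) s' T' Q) :
    Runs (block (p :: l)) s (T + T') Q := by
  obtain ⟨t, s', h1, h2, t', s'', h3, h4, h5⟩ := h
  exact ⟨_, s'', .seq h1 h3, by omega, h5⟩

/-! The values that are written are named, which keeps the descriptions of states short. -/

theorem Runs.block_const {c : ℤ} (h : Runs (block l) (s.setReg x c) T Q) :
    Runs (block (.const x c :: l)) s (T + 1) Q :=
  (Runs.block_cons (T := 1) ⟨1, _, .const s x c, le_rfl, h⟩).mono (by omega) fun _ h => h

theorem Runs.block_add
    (h : ∀ v, v = s.reg y + s.reg z → Runs (block l) (s.setReg x v) T Q) :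
    Runs (block (.add x y z :: l)) s (T + 1) Q :=
  (Runs.block_cons (T := 1) ⟨1, _, .add s x y z, le_rfl, h _ rfl⟩).mono (by omega) fun _ h => h

theorem Runs.block_sub
    (h : ∀ v, v = s.reg y - s.reg z → Runs (block l) (s.setReg x v) T Q) :
    Runs (block (.sub x y z :: l)) s (T + 1) Q :=
  (Runs.block_cons (T := 1) ⟨1, _, .sub s x y z, le_rfl, h _ rfl⟩).mono (by omega) fun _ h => h

theorem Runs.block_load
    (h : ∀ v, v = s.mem (s.reg y) → Runs (block l) (s.setReg x v) T Q) :
    Runs (block (.load x y :: l)) s (T + 1) Q :=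
  (Runs.block_cons (T := 1) ⟨1, _, .load s x y, le_rfl, h _ rfl⟩).mono (by omega) fun _ h => h

theorem Runs.block_store
    (h : ∀ a v, a = s.reg x → v = s.reg y → Runs (block l) (s.setMem a v) T Q) :
    Runs (block (.store x y :: l)) s (T + 1) Q :=
  (Runs.block_cons (T := 1) ⟨1, _, .store s x y, le_rfl, h _ _ rfl rfl⟩).mono (by omega)
    fun _ h => h

/-- Both outcomes are described as a write to `z`, so that a sequence of checks needs no case
distinction. A successful check writes back the old value. -/
theorem Runs.block_require
    (h : ∀ v, v = (if s.reg x ≤ s.reg y then s.reg z else 0) →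
      Runs (block l) (s.setReg z v) T Q) :
    Runs (block (require x y z :: l)) s (T + 2) Q := by
  have h := h _ rfl
  refine (Runs.block_cons (T := 2) (T' := T) (Q := Q) (.ifLe (T := 1)
    (fun hxy => .skip (T := 0) ?_) fun hxy => .const (T := 0) ?_)).mono (by omega) fun _ h => h
  · rw [if_pos hxy] at h
    have : s.setReg z (s.reg z) = s := by simp [State.setReg]
    rwa [this] at h
  · rwa [if_neg (not_le.2 hxy)] at h

end Block

theorem length_le_bitSize (w : List ℤ) : w.length ≤ bitSize w := by
  induction w with
  | nil => simp
  | cons z w ih => simp only [bitSize, List.map_cons, List.sum_cons, List.length_cons] at *; omega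

end RAM

namespace Timetable

open RAM

/-! ### The program

Register `0` holds the length of the input, register `1` the number `1`, register `2` the number of
trips plus one, register `3` the last address of the input and register `7` the number `0`. A trip
is represented by the address `a` of its first word; the address of its owner, or `0`, is in the
memory cell `-2 * a` and its price in the cell `-2 * a - 1`. -/

/-- Decide whether the trip at `reg 20` is earlier than the trip at `reg 21`. -/
def compareProg : Prog := block [.const 22 1, .load 23 20, .load 24 21, require 23 24 22,
  require 24 23 22, .ifLe 1 22 (.whileLe 1 23 (block [
    .add 20 20 1, .add 21 21 1, .load 24 20, .load 25 21, require 24 25 22, require 25 24 22,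
    .add 20 20 1, .add 21 21 1, .load 24 20, .load 25 21, require 24 25 22,
    .add 20 20 1, .add 21 21 1, .load 24 20, .load 25 21, require 24 25 22,
    .sub 23 23 1])) .skip]

/-- Decide whether the trip at `reg 5` precedes the trip at `reg 12`. -/
def precedesProg : Prog := block [.const 15 0, .add 20 5 7, .add 21 12 7, compareProg,
  .ifLe 1 22 (block [.add 20 12 7, .add 21 5 7, compareProg, .add 16 5 1,
    .ifLe 1 22 (.ifLe 16 12 (.const 15 1) .skip) (.const 15 1)]) .skip]

/-- Go from the trip at `reg x` to the next one. -/
def nextProg (x : ℕ) : List Prog :=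
  [.load 13 x, .add x x 13, .add x x 13, .add x x 13, .add x x 1]

/-- Find a cheapest successor of the trip at `reg 5`. -/
def scanProg : Prog := block [.const 10 0, .add 11 2 7, .const 12 1, .whileLe 12 3 (block ([
    .sub 14 7 12, .sub 14 14 12, .sub 14 14 1, .load 13 14, .add 13 13 1,
    .ifLe 13 11 (block [precedesProg, .ifLe 1 15 (block [.add 10 12 7, .sub 11 13 1]) .skip]) .skip]
    ++ nextProg 12))]

/-- The trip at `reg 5` buys a cheapest successor, and the trip that owned it takes its place. -/
def bidProg : Prog := block [scanProg, .ifLe 1 10 (block [.sub 14 7 10, .sub 14 14 10, .load 13 14,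
  .store 14 5, .sub 14 14 1, .add 11 11 1, .store 14 11, .add 5 13 7]) (.const 5 0)]

/-- All trips bid. -/
def auctionProg : Prog := block [.const 4 1, .whileLe 4 3 (block ([
  .add 5 4 7, .whileLe 1 5 bidProg] ++ nextProg 4))]

/-- Label each trip with the first trip of its chain. -/
def labelProg : Prog := block [.const 6 0, .const 4 1, .whileLe 4 3 (block ([
  .add 5 4 7, .sub 14 7 5, .sub 14 14 5, .load 13 14,
  .whileLe 1 13 (block [.add 5 13 7, .sub 14 7 5, .sub 14 14 5, .load 13 14])] ++ nextProg 4 ++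
  [.store 6 5, .add 6 6 1])), .add 0 6 7]

/-- The whole algorithm. -/
def groupingProg : Prog := block [.const 1 1, .sub 3 0 1, .load 2 7, .add 2 2 1, auctionProg,
  labelProg]

/-! ### Time bounds, as expressions over any commutative semiring -/

section Time

variable {R : Type*} [CommSemiring R] (x : R)

/-- A bound for the time that `compareProg` takes on an input of length `x`. -/
def compareTime : R := x * 31 + 12

/-- A bound for the time that `precedesProg` takes on an input of length `x`. -/
def precedesTime : R := compareTime x * 2 + 20

/-- A bound for the time that `scanProg` takes on an input of length `x`. -/
def scanTime : R := x * (precedesTime x + 31) + 10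

/-- A bound for the time that `bidProg` takes on an input of length `x`. -/
def bidTime : R := scanTime x + 20

/-- A bound for the time that `auctionProg` takes on an input of length `x`. -/
def auctionTime : R := x * ((x * x + 1) * (bidTime x + 1) + 20) + 20

/-- A bound for the time that `labelProg` takes on an input of length `x`. -/
def labelTime : R := x * (x * 10 + 30) + 20

/-- A bound for the time that `groupingProg` takes on an input of length `x`. -/
def groupingTime : R := auctionTime x + labelTime x + 20

end Time

/-! ### Correctness of the comparison of trips -/

/-- The conventions about registers and memory. -/
structure Ready (T : List Trip) (s : State) : Prop where
  reg_one : s.reg 1 = 1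
  reg_two : s.reg 2 = T.length + 1
  reg_three : s.reg 3 = (encodeTrips T).length - 1
  reg_seven : s.reg 7 = 0
  mem : ∀ a, 0 ≤ a → s.mem a = word T a

/-- Registers from 10 on are scratch space, so subroutines that change only those preserve the
conventions. -/
theorem Ready.congr {T : List Trip} {s s' : State} (h : Ready T s)
    (hreg : ∀ x < 10, s'.reg x = s.reg x) (hmem : s'.mem = s.mem) : Ready T s' where
  reg_one := by rw [hreg _ (by norm_num), h.reg_one]
  reg_two := by rw [hreg _ (by norm_num), h.reg_two]
  reg_three := by rw [hreg _ (by norm_num), h.reg_three]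
  reg_seven := by rw [hreg _ (by norm_num), h.reg_seven]
  mem := by rw [hmem]; exact h.mem

theorem length_events_lt {T : List Trip} {i : ℕ} (hi : i < T.length) :
    T[i].events.length ≤ (encodeTrips T).length := by
  have h1 := pos_succ T i hi
  have h2 := pos_le_pos (T := T) (i := i + 1) hi le_rfl
  rw [pos_length] at h2
  omega

/-- The loop body of `compareProg`. -/
theorem runs_compareBody {s : State} {a b c : ℤ} {p : Prop} [Decidable p] (h1 : s.reg 1 = 1)
    (ha : s.reg 20 = a) (hb : s.reg 21 = b) (hc : s.reg 23 = c)
    (hp : s.reg 22 = if p then 1 else 0) :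
    Runs (block [
      .add 20 20 1, .add 21 21 1, .load 24 20, .load 25 21, require 24 25 22, require 25 24 22,
      .add 20 20 1, .add 21 21 1, .load 24 20, .load 25 21, require 24 25 22,
      .add 20 20 1, .add 21 21 1, .load 24 20, .load 25 21, require 24 25 22,
      .sub 23 23 1]) s 30 fun s' => s'.mem = s.mem ∧ (∀ x < 20, s'.reg x = s.reg x) ∧
        s'.reg 20 = a + 3 ∧ s'.reg 21 = b + 3 ∧ s'.reg 23 = c - 1 ∧
        s'.reg 22 = if p ∧ s.mem (a + 1) = s.mem (b + 1) ∧ s.mem (a + 2) ≤ s.mem (b + 2) ∧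
          s.mem (a + 3) ≤ s.mem (b + 3) then 1 else 0 := by
  refine .block_add fun v₁ e₁ => .block_add fun v₂ e₂ => .block_load fun v₃ e₃ =>
    .block_load fun v₄ e₄ => .block_require fun v₅ e₅ => .block_require fun v₆ e₆ =>
    .block_add fun v₇ e₇ => .block_add fun v₈ e₈ => .block_load fun v₉ e₉ =>
    .block_load fun w₁ f₁ => .block_require fun w₂ f₂ => .block_add fun w₃ f₃ =>
    .block_add fun w₄ f₄ => .block_load fun w₅ f₅ => .block_load fun w₆ f₆ =>
    .block_require fun w₇ f₇ => .block_sub fun w₈ f₈ => .block_nil ?_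
  simp [ha, hb, hc, hp, h1] at e₁ e₂ e₃ e₄ e₅ e₆ e₇ e₈ e₉ f₁ f₂ f₃ f₄ f₅ f₆ f₇ f₈
  simp
  refine ⟨fun x hx => ?_, by omega, by omega, by omega, ?_⟩
  · split_ifs <;> omega
  · rw [e₁] at e₃ e₇
    rw [e₂] at e₄ e₈
    rw [add_assoc, one_add_one_eq_two] at e₇ e₈
    rw [e₇] at e₉ f₃
    rw [e₈] at f₁ f₄
    rw [add_assoc, show (2 : ℤ) + 1 = 3 by norm_num] at f₃ f₄
    rw [f₃] at f₅
    rw [f₄] at f₆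
    rw [← e₃, ← e₄, ← e₉, ← f₁, ← f₅, ← f₆]
    clear e₃ e₄ e₉ f₁ f₅ f₆
    rw [f₇, f₂, e₆, e₅]
    -- The program tests equality of stops by two inequalities.
    split_ifs <;> first | rfl | (exfalso; simp only [le_antisymm_iff] at *; tauto)

open Classical in
theorem runs_compareProg {T : List Trip} {s : State} (hs : Ready T s) (i j : Fin T.length)
    (hi : s.reg 20 = pos T i) (hj : s.reg 21 = pos T j) :
    Runs compareProg s (compareTime (encodeTrips T).length) fun s' =>
      s'.mem = s.mem ∧ (∀ x < 20, s'.reg x = s.reg x) ∧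
        s'.reg 22 = if (T.get i).Earlier (T.get j) then 1 else 0 := by
  have hwi : s.mem (pos T i) = (T.get i).events.length := by
    rw [hs.mem _ (by positivity), word_pos T i i.2]; rfl
  have hwj : s.mem (pos T j) = (T.get j).events.length := by
    rw [hs.mem _ (by positivity), word_pos T j j.2]; rfl
  refine .block_const <| .block_load fun v₁ e₁ => .block_load fun v₂ e₂ =>
    .block_require fun v₃ e₃ => .block_require fun v₄ e₄ =>
    .block_cons (T := (encodeTrips T).length * 31 + 2) (T' := 3)
      (.ifLe (T := (encodeTrips T).length * 31 + 1) (fun h => ?_) fun h => .skip (.block_nil ?_))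
  all_goals
    simp only [State.reg_setReg, State.mem_setReg, Nat.reduceEqDiff, reduceIte, hi, hj, hwi,
      hwj] at e₁ e₂ e₃ e₄
    simp [hs.reg_one] at h
  · have hlen : (T.get i).events.length = (T.get j).events.length := by
      rw [e₄, e₃, e₁, e₂] at h
      split_ifs at h <;> omega
    have hv₄ : v₄ = 1 := by rw [e₄, e₃, e₁, e₂, hlen]; simp
    let ok : ℕ → Prop := fun k => s.mem (pos T i + (3 * k + 1)) = s.mem (pos T j + (3 * k + 1)) ∧
      s.mem (pos T i + (3 * k + 2)) ≤ s.mem (pos T j + (3 * k + 2)) ∧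
      s.mem (pos T i + (3 * k + 3)) ≤ s.mem (pos T j + (3 * k + 3))
    -- Here `d` events have been compared and `k` remain. The addresses advance by 3 per event and
    -- start at the length words, which is why the body increments before it loads.
    refine Runs.whileLe (fun k s' => ∃ d, d + k = (T.get i).events.length ∧ s'.mem = s.mem ∧
        (∀ x < 20, s'.reg x = s.reg x) ∧ s'.reg 20 = pos T i + 3 * d ∧
        s'.reg 21 = pos T j + 3 * d ∧ s'.reg 23 = k ∧
        s'.reg 22 = if ∀ e < d, ok e then 1 else 0) 30 ?_ ?_
      (length_events_lt i.2) ⟨0, by simp, rfl, ?_⟩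
    · rintro k s' ⟨d, hd, hmem, hreg, h20, h21, h23, h22⟩ hk
      have h1 : s'.reg 1 = 1 := by rw [hreg _ (by norm_num), hs.reg_one]
      rw [h1, h23] at hk
      refine (runs_compareBody h1 h20 h21 h23 h22).mono le_rfl ?_
      rintro s'' ⟨g1, g2, g3, g4, g5, g6⟩
      refine ⟨k - 1, by omega, d + 1, by omega, g1.trans hmem, fun x hx => (g2 x hx).trans
        (hreg x hx), by rw [g3]; push_cast; ring, by rw [g4]; push_cast; ring, by omega, ?_⟩
      rw [g6]
      congr 1
      have : (∀ e < d + 1, ok e) ↔ (∀ e < d, ok e) ∧ ok d :=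
        ⟨fun h => ⟨fun e he => h e (by omega), h d (by omega)⟩, fun h e he => by
          rcases Nat.lt_succ_iff_lt_or_eq.1 he with h' | rfl
          · exact h.1 e h'
          · exact h.2⟩
      rw [this, hmem]
      simp only [ok, add_assoc]
    · rintro k s' ⟨d, hd, hmem, hreg, h20, h21, h23, h22⟩ hk
      have h1 : s'.reg 1 = 1 := by rw [hreg _ (by norm_num), hs.reg_one]
      rw [h1, h23] at hk
      obtain rfl : d = (T.get i).events.length := by omega
      refine .block_nil ⟨hmem, hreg, ?_⟩
      rw [h22]
      congr 1
      rw [earlier_get_iff, eq_iff_iff]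
      simp only [hlen, true_and, ok]
      have e : ∀ (k : Fin T.length) (e c : ℕ),
          s.mem (pos T k + (3 * e + c)) = word T (pos T k + (3 * e + c)) :=
        fun k e c => hs.mem _ (by positivity)
      have e1 := fun k a => e k a 1
      have e2 := fun k a => e k a 2
      have e3 := fun k a => e k a 3
      push_cast at e1 e2 e3
      simp only [e1, e2, e3]
    · simp [hi, hj, hv₄]
      refine ⟨fun x hx => ?_, e₁⟩
      split_ifs <;> omega
  · have hne : ¬ (T.get i).Earlier (T.get j) := fun hE => by
      have := ((earlier_get_iff T i j).1 hE).1
      have : v₄ = 1 := by rw [e₄, e₃, e₁, e₂, this]; simp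
      omega
    rw [if_neg hne]
    simp
    refine ⟨fun x hx => by split_ifs <;> omega, ?_⟩
    split_ifs at e₃ e₄ <;> omega

open Classical in
theorem runs_precedesProg {T : List Trip} {s : State} (hs : Ready T s) (i j : Fin T.length)
    (hi : s.reg 5 = pos T i) (hj : s.reg 12 = pos T j) :
    Runs precedesProg s (precedesTime (encodeTrips T).length) fun s' =>
      s'.mem = s.mem ∧ (∀ x < 15, s'.reg x = s.reg x) ∧
        s'.reg 15 = if Precedes T i j then 1 else 0 := by
  refine .mono (T := 3 + (compareTime (encodeTrips T).length + (compareTime (encodeTrips T).length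
    + 10)) + 3) ?_ (by simp only [precedesTime]; omega) fun _ h => h
  refine .block_const <| .block_add fun v₁ e₁ => .block_add fun v₂ e₂ => ?_
  simp [hs.reg_seven, hi, hj] at e₁ e₂
  refine Runs.block_cons (T := compareTime (encodeTrips T).length)
    (T' := compareTime (encodeTrips T).length + 13) ?_ |>.mono (by omega) fun _ h => h
  have hs' : Ready T (((s.setReg 15 0).setReg 20 v₁).setReg 21 v₂) :=
    hs.congr (fun x hx => by simp; split_ifs <;> omega) (by simp)
  refine (runs_compareProg hs' i j (by simp [e₁]) (by simp [e₂])).mono le_rfl ?_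
  rintro s₁ ⟨hmem, hreg, h22⟩
  have hs₁ : Ready T s₁ := hs'.congr (fun x hx => hreg x (by omega)) hmem
  have hreg₁ : ∀ x < 15, s₁.reg x = s.reg x := fun x hx => by
    rw [hreg x (by omega)]; simp; split_ifs <;> omega
  have h15 : s₁.reg 15 = 0 := by rw [hreg 15 (by omega)]; simp
  refine Runs.block_cons (T := compareTime (encodeTrips T).length + 12) (T' := 1)
    (.ifLe (fun h => ?_) fun h => ?_)
  · have hE : (T.get i).Earlier (T.get j) := by
      rw [hs₁.reg_one, h22] at h
      by_contra hE
      simp only [if_neg hE] at h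
      omega
    refine .mono (T := compareTime (encodeTrips T).length + 9 + 1 + 1) ?_ (by omega)
      fun _ h => h
    refine .block_add fun w₁ f₁ => .block_add fun w₂ f₂ => ?_
    simp [hs₁.reg_seven, hreg₁, hi, hj] at f₁ f₂
    refine Runs.block_cons (T := compareTime (encodeTrips T).length) (T' := 9) ?_
    have hs₂ : Ready T ((s₁.setReg 20 w₁).setReg 21 w₂) :=
      hs₁.congr (fun x hx => by simp; split_ifs <;> omega) (by simp)
    refine (runs_compareProg hs₂ j i (by simp [f₁]) (by simp [f₂])).mono le_rfl ?_
    rintro s₂ ⟨hmem₂, hreg₂, h22₂⟩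
    have hs₂' : Ready T s₂ := hs₂.congr (fun x hx => hreg₂ x (by omega)) hmem₂
    have hreg₂' : ∀ x < 16, s₂.reg x = s₁.reg x := fun x hx => by
      rw [hreg₂ x (by omega)]; simp; split_ifs <;> omega
    refine .block_add fun v e => ?_
    simp [hs₂'.reg_one, hreg₂', hreg₁, hi] at e
    have hmem' : s₂.mem = s.mem := by rw [hmem₂]; simp [hmem]
    -- Only the tie-break is left to decide. The program compares the addresses in place of the
    -- indices.
    have key : ((T.get j).Earlier (T.get i) → i < j) ↔ Precedes T i j := ⟨fun h => ⟨hE, h⟩, (·.2)⟩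
    refine Runs.block_cons (T := 5) (T' := 3) (.ifLe (fun h => .ifLe (fun h' => .const ?_)
      fun h' => .skip ?_) fun h => .const ?_)
    all_goals
      simp [hs₂'.reg_one, h22₂] at h
      try simp [hreg₂', hreg₁, hj, e] at h'
      refine .block_nil (.block_nil ?_)
      simp only [State.mem_setReg, State.reg_setReg, hmem', true_and]
      refine ⟨fun x hx => ?_, ?_⟩
    · simp [show x ≠ 15 by omega, show x ≠ 16 by omega, hreg₂' x (by omega), hreg₁ x hx]
    · rw [if_pos trivial, if_pos]
      rw [← key]
      intro _
      by_contra hij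
      have := pos_le_pos (T := T) (not_lt.1 hij) i.2.le
      omega
    · simp [show x ≠ 16 by omega, hreg₂' x (by omega), hreg₁ x hx]
    · rw [if_neg (by norm_num), hreg₂' 15 (by omega), h15, if_neg]
      rw [← key]
      intro hij
      have hE' : (T.get j).Earlier (T.get i) := by
        by_contra hE'
        simp at hE'
        simp [hE'] at h
      have := pos_lt_pos (T := T) (hij hE') j.2.le
      omega
    · simp [show x ≠ 15 by omega, show x ≠ 16 by omega, hreg₂' x (by omega), hreg₁ x hx]
    · rw [if_pos trivial, if_pos]
      rw [← key]
      intro hE'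
      simp at hE'
      simp [hE'] at h
  · refine .skip (.block_nil ⟨by simp [hmem], hreg₁, ?_⟩)
    rw [h15, if_neg]
    intro hP
    rw [hs₁.reg_one, h22, if_pos hP.1] at h
    omega

/-- The last steps of a loop body lead to the next trip. -/
theorem runs_nextProg {T : List Trip} {s : State} {i : ℕ} (hi : i < T.length)
    (h1 : s.reg 1 = 1) (hmem : s.mem (pos T i) = word T (pos T i)) {x : ℕ}
    (hx : s.reg x = pos T i) (hx1 : x ≠ 1) (hx13 : x ≠ 13) {l : List Prog} {t : ℕ}
    {Q : State → Prop}
    (h : ∀ s' : State, s'.mem = s.mem → (∀ y, y ≠ x → y ≠ 13 → s'.reg y = s.reg y) →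
      s'.reg x = (pos T (i + 1) : ℕ) → Runs (block l) s' t Q) :
    Runs (block (nextProg x ++ l)) s (t + 5) Q := by
  refine .block_load fun v₁ e₁ => .block_add fun v₂ e₂ => .block_add fun v₃ e₃ =>
    .block_add fun v₄ e₄ => .block_add fun v₅ e₅ => h _ ?_ ?_ ?_
  · simp
  · intro y hy hy'
    simp [hy, hy']
  · rw [hx, hmem, word_pos T i hi] at e₁
    simp [hx, hx1.symm, hx13, hx13.symm, h1] at e₁ e₂ e₃ e₄ e₅
    simp [pos_succ T i hi]
    omega

/-- Loops over all trips. -/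
theorem runs_forTrips {T : List Trip} {x : ℕ} {p : Prog} {s : State} {Q : State → Prop}
    (J : ℕ → State → Prop) (t : ℕ) (h3 : ∀ i s, J i s → s.reg 3 = (encodeTrips T).length - 1)
    (hstep : ∀ i s, i < T.length → J i s → s.reg x = pos T i →
      Runs p s t fun s' => s'.reg x = (pos T (i + 1) : ℕ) ∧ J (i + 1) s')
    (hexit : ∀ s, J T.length s → Q s) (hx : s.reg x = 1) (h0 : J 0 s) :
    Runs (.whileLe x 3 p) s ((encodeTrips T).length * (t + 1) + 1) Q := by
  refine Runs.whileLe (fun k s => ∃ i, i + k = T.length ∧ s.reg x = pos T i ∧ J i s) t ?_ ?_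
    (length_le T).le ⟨0, by simp, by simp [hx, pos_zero], h0⟩
  · rintro k s ⟨i, hik, hx, hJ⟩ hle
    have hi : i < T.length := by
      by_contra hi
      obtain rfl : i = T.length := by omega
      rw [hx, h3 _ _ hJ, pos_length] at hle
      omega
    exact (hstep i s hi hJ hx).mono le_rfl fun s' h => ⟨k - 1, by omega, i + 1, by omega, h⟩
  · rintro k s ⟨i, hik, hx, hJ⟩ hlt
    have hi : i = T.length := by
      by_contra hi
      have := pos_lt_pos (T := T) (i := i) (j := T.length) (by omega) le_rfl
      rw [pos_length] at this
      rw [hx, h3 _ _ hJ] at hlt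
      omega
    exact hexit s (hi ▸ hJ)

/-! ### The auction on the machine -/

/-- The address of a trip, or `0`. -/
def address (T : List Trip) : Option (Fin T.length) → ℤ
  | none => 0
  | some i => pos T i

/-- Owners and prices are stored in the memory. -/
def Stored (T : List Trip) (own : Fin T.length → Option (Fin T.length)) (price : Fin T.length → ℕ)
    (s : State) : Prop :=
  ∀ j : Fin T.length, s.mem (0 - pos T j - pos T j) = address T (own j) ∧
    s.mem (0 - pos T j - pos T j - 1) = price j

variable {T : List Trip} {own : Fin T.length → Option (Fin T.length)} {price : Fin T.length → ℕ}

theorem runs_scanProg {s : State} (hs : Ready T s) (hst : Stored T own price s)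
    (i : Fin T.length) (hi : s.reg 5 = pos T i) :
    Runs scanProg s (scanTime (encodeTrips T).length) fun s' =>
      s'.mem = s.mem ∧ (∀ x < 10, s'.reg x = s.reg x) ∧
      ((s'.reg 10 = 0 ∧ ∀ k, Precedes T i k → T.length + 1 ≤ price k) ∨
        ∃ j, Precedes T i j ∧ price j ≤ T.length ∧ (∀ k, Precedes T i k → price j ≤ price k) ∧
          s'.reg 10 = pos T j ∧ s'.reg 11 = price j) := by
  classical
  refine .mono (T := ((encodeTrips T).length * (precedesTime (encodeTrips T).length + 31) + 2) + 2
    + 1) ?_ (by simp only [scanTime]; omega) fun _ h => h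
  refine .block_const <| .block_add fun v₁ e₁ => .block_const <| .block_cons (T' := 1)
    (T := (encodeTrips T).length * (precedesTime (encodeTrips T).length + 31) + 1) ?_
  simp [hs.reg_two, hs.reg_seven] at e₁
  -- The best price starts at n + 1 and only strictly cheaper successors replace it. If none is
  -- found, all successors cost at least n + 1, which is the condition for giving up.
  refine runs_forTrips (T := T) (fun m s' => s'.mem = s.mem ∧ (∀ x < 10, s'.reg x = s.reg x) ∧
    ((s'.reg 10 = 0 ∧ s'.reg 11 = T.length + 1 ∧
        ∀ k : Fin T.length, k < m → Precedes T i k → T.length + 1 ≤ price k) ∨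
      ∃ j, Precedes T i j ∧ price j ≤ T.length ∧
        (∀ k : Fin T.length, k < m → Precedes T i k → price j ≤ price k) ∧
        s'.reg 10 = pos T j ∧ s'.reg 11 = price j)) _ ?_ ?_ ?_ (by simp) ?_
  · rintro m s' ⟨-, h, -⟩
    rw [h 3 (by norm_num), hs.reg_three]
  · rintro m s₁ hm ⟨hmem, hreg, hinv⟩ h12
    have hs₁ : Ready T s₁ := hs.congr hreg hmem
    refine .mono (T := precedesTime (encodeTrips T).length + 6 + 6 + 1 + 1 + 1 + 1 + 1) ?_
      (by omega) fun _ h => h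
    refine .block_sub fun v₁ e₁ => .block_sub fun v₂ e₂ => .block_sub fun v₃ e₃ =>
      .block_load fun v₄ e₄ => .block_add fun v₅ e₅ => ?_
    simp [hs₁.reg_seven, hs₁.reg_one, h12] at e₁ e₂ e₃ e₄ e₅
    have hprice := (hst ⟨m, hm⟩).2
    replace e₄ : v₄ = price ⟨m, hm⟩ := by
      rw [e₄, e₃, e₂, e₁, hmem, ← hprice]
      simp
    refine Runs.block_cons (T := precedesTime (encodeTrips T).length + 5 + 1) (T' := 6)
      (Runs.mono (Q := fun s₃ => s₃.mem = s.mem ∧ (∀ x < 10, s₃.reg x = s.reg x) ∧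
        s₃.reg 12 = pos T m ∧ ((s₃.reg 10 = 0 ∧ s₃.reg 11 = T.length + 1 ∧
          ∀ k : Fin T.length, k < m + 1 → Precedes T i k → T.length + 1 ≤ price k) ∨
        ∃ j, Precedes T i j ∧ price j ≤ T.length ∧
          (∀ k : Fin T.length, k < m + 1 → Precedes T i k → price j ≤ price k) ∧
          s₃.reg 10 = pos T j ∧ s₃.reg 11 = price j)) (.ifLe (fun h => ?_) fun h => ?_) le_rfl ?_)
    · simp [e₅, e₄] at h
      refine Runs.block_cons (T := precedesTime (encodeTrips T).length) (T' := 5) ?_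
      have hs₂ : Ready T (((((s₁.setReg 14 v₁).setReg 14 v₂).setReg 14 v₃).setReg 13 v₄).setReg
          13 v₅) := hs₁.congr (fun x hx => by simp; split_ifs <;> omega) (by simp)
      refine (runs_precedesProg hs₂ i ⟨m, hm⟩ (by simp [hreg, hi]) (by simp [h12])).mono le_rfl ?_
      rintro s₂ ⟨hmem₂, hreg₂, h15⟩
      have hreg₂' : ∀ x < 13, s₂.reg x = s₁.reg x := fun x hx => by
        rw [hreg₂ x (by omega)]; simp; split_ifs <;> omega
      have h13 : s₂.reg 13 = price ⟨m, hm⟩ + 1 := by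
        rw [hreg₂ 13 (by omega)]; simp [e₅, e₄]
      have hmem₂' : s₂.mem = s.mem := hmem₂.trans hmem
      have h1 : s₂.reg 1 = 1 := by rw [hreg₂' 1 (by omega), hs₁.reg_one]
      refine Runs.block_cons (T := 4) (T' := 1) (.ifLe (fun h' => ?_) fun h' => ?_)
      · have hP : Precedes T i ⟨m, hm⟩ := by
          by_contra hP
          rw [h1, h15, if_neg hP] at h'
          omega
        refine .block_add fun w₁ f₁ => .block_sub fun w₂ f₂ => .block_nil (.block_nil ?_)
        simp [hreg₂', h12, hs₁.reg_seven, h13, hs₁.reg_one] at f₁ f₂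
        simp only [State.mem_setReg, State.reg_setReg, hmem₂', true_and]
        refine ⟨fun x hx => ?_, ?_, .inr ⟨⟨m, hm⟩, hP, ?_, ?_, ?_, ?_⟩⟩
        · simp [show x ≠ 10 by omega, show x ≠ 11 by omega, hreg₂' x (by omega), hreg x hx]
        · simp [hreg₂', h12]
        · rcases hinv with hinv | ⟨j, hj1, hj2, hj3, hj4, hj5⟩ <;> omega
        · intro k hk hik
          rcases Nat.lt_succ_iff_lt_or_eq.1 hk with hk | hk
          · rcases hinv with hinv | ⟨j, hj1, hj2, hj3, hj4, hj5⟩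
            · have := hinv.2.2 k hk hik; omega
            · have := hj3 k hk hik; omega
          · rw [show k = ⟨m, hm⟩ from Fin.ext hk]
        · simp [f₁]
        · simp [f₂]
      · have hP : ¬ Precedes T i ⟨m, hm⟩ := fun hP => by
          rw [h1, h15, if_pos hP] at h'
          omega
        refine .skip (.block_nil ⟨hmem₂', fun x hx => (hreg₂' x (by omega)).trans (hreg x hx),
          (hreg₂' 12 (by omega)).trans h12, ?_⟩)
        rw [hreg₂' 10 (by omega), hreg₂' 11 (by omega)]
        have hlt : ∀ k : Fin T.length, k < m + 1 → Precedes T i k → k < m := fun k hk hik => by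
          rcases Nat.lt_succ_iff_lt_or_eq.1 hk with hk | hk
          · exact hk
          · exact absurd (show k = ⟨m, hm⟩ from Fin.ext hk) fun e => hP (e ▸ hik)
        rcases hinv with hinv | ⟨j, hj1, hj2, hj3, hj⟩
        · exact .inl ⟨hinv.1, hinv.2.1, fun k hk hik => hinv.2.2 k (hlt k hk hik) hik⟩
        · exact .inr ⟨j, hj1, hj2, fun k hk hik => hj3 k (hlt k hk hik) hik, hj⟩
    · simp [e₅, e₄] at h
      refine .skip ⟨hmem, fun x hx => ?_, by simp [h12], ?_⟩
      · simp [show x ≠ 13 by omega, show x ≠ 14 by omega, hreg x hx]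
      · simp only [State.reg_setReg, Nat.reduceEqDiff, reduceIte]
        rcases hinv with hinv | ⟨j, hj1, hj2, hj3, hj⟩
        · refine .inl ⟨hinv.1, hinv.2.1, fun k hk hik => ?_⟩
          rcases Nat.lt_succ_iff_lt_or_eq.1 hk with hk | hk
          · exact hinv.2.2 k hk hik
          · rw [show k = ⟨m, hm⟩ from Fin.ext hk]; omega
        · refine .inr ⟨j, hj1, hj2, fun k hk hik => ?_, hj⟩
          rcases Nat.lt_succ_iff_lt_or_eq.1 hk with hk | hk
          · exact hj3 k hk hik
          · rw [show k = ⟨m, hm⟩ from Fin.ext hk]; omega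
    · rintro s₃ ⟨hmem₃, hreg₃, h12₃, hinv₃⟩
      have hs₃ : Ready T s₃ := hs.congr hreg₃ hmem₃
      refine runs_nextProg (l := []) (t := 1) hm hs₃.reg_one (hs₃.mem _ (by positivity))
        h12₃ (by norm_num) (by norm_num)
        fun s₄ hmem₄ hreg₄ h12₄ => .block_nil ⟨h12₄, hmem₄.trans hmem₃, fun x hx =>
          (hreg₄ x (by omega) (by omega)).trans (hreg₃ x hx), ?_⟩
      rwa [hreg₄ 10 (by norm_num) (by norm_num), hreg₄ 11 (by norm_num) (by norm_num)]
  · rintro s' ⟨hmem, hreg, h | ⟨j, h1, h2, h3, h⟩⟩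
    · exact .block_nil ⟨hmem, hreg, .inl ⟨h.1, fun k => h.2.2 k k.2⟩⟩
    · exact .block_nil ⟨hmem, hreg, .inr ⟨j, h1, h2, fun k => h3 k k.2, h⟩⟩
  · refine ⟨by simp, fun x hx => by simp; split_ifs <;> omega, .inl ⟨by simp, by simp [e₁], ?_⟩⟩
    intro k hk; omega

theorem pos_injective {i j : Fin T.length} (h : pos T i = pos T j) : i = j := by
  rcases lt_trichotomy i j with hij | hij | hij
  · have := pos_lt_pos (T := T) hij j.2.le; omega
  · exact hij
  · have := pos_lt_pos (T := T) hij i.2.le; omega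

/-- The two outcomes match `Auction.giveUp` and `Auction.bid`. Register 5 receives the evicted owner
as the next bidder, or 0 to end the bidding. -/
theorem runs_bidProg {s : State} (hs : Ready T s) (hst : Stored T own price s)
    (i : Fin T.length) (hi : s.reg 5 = pos T i) :
    Runs bidProg s (bidTime (encodeTrips T).length) fun s' =>
      Ready T s' ∧ s'.reg 4 = s.reg 4 ∧
      ((s'.reg 5 = 0 ∧ Stored T own price s' ∧ ∀ k, Precedes T i k → T.length + 1 ≤ price k) ∨
        ∃ j, Precedes T i j ∧ price j ≤ T.length ∧ (∀ k, Precedes T i k → price j ≤ price k) ∧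
          s'.reg 5 = address T (own j) ∧
          Stored T (Function.update own j (some i))
            (Function.update price j (price j + 1)) s') := by
  refine Runs.block_cons (T := scanTime (encodeTrips T).length) (T' := 20)
    ((runs_scanProg hs hst i hi).mono le_rfl ?_)
  rintro s₁ ⟨hmem, hreg, hres⟩
  have hs₁ : Ready T s₁ := hs.congr hreg hmem
  refine Runs.block_cons (T := 19) (T' := 1) (.ifLe (fun h => ?_) fun h => ?_)
  · rw [hs₁.reg_one] at h
    obtain ⟨j, h1, h2, h3, h10, h11⟩ := hres.resolve_left fun h' => by omega
    refine .block_sub fun v₁ e₁ => .block_sub fun v₂ e₂ => .block_load fun v₃ e₃ =>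
      .block_store fun a v₄ ea e₄ => .block_sub fun v₅ e₅ => .block_add fun v₆ e₆ =>
      .block_store fun b v₇ eb e₇ => .block_add fun v₈ e₈ => .block_nil (.block_nil ?_)
    simp [hs₁.reg_seven, hs₁.reg_one, h10, h11, hreg, hi] at e₁ e₂ e₃ ea e₄ e₅ e₆ eb e₇ e₈
    have hp := one_le_pos T j
    have ha : a = 0 - pos T j - pos T j := by omega
    have hb : b = 0 - pos T j - pos T j - 1 := by omega
    have hv₃ : v₃ = address T (own j) := by
      rw [e₃, hmem, ← (hst j).1]; congr 1; omega
    refine ⟨⟨?_, ?_, ?_, ?_, ?_⟩, by simp [hreg], .inr ⟨j, h1, h2, h3, by simp; omega, ?_⟩⟩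
    · simp [hs₁.reg_one]
    · simp [hs₁.reg_two]
    · simp [hs₁.reg_three]
    · simp [hs₁.reg_seven]
    · intro c hc
      -- Owners and prices are kept at negative addresses, so the input stays intact.
      have hca : c ≠ a := by omega
      have hcb : c ≠ b := by omega
      simp [hca, hcb, hs₁.mem c hc]
    · intro k
      have hk := one_le_pos T k
      by_cases hkj : k = j
      · subst hkj
        rw [← hb, ← ha]
        have hab : a ≠ b := by omega
        simp [hab]
        exact ⟨e₄, by omega⟩
      · have hne : pos T k ≠ pos T j := fun h => hkj (pos_injective h)
        have h4 : (0 : ℤ) - pos T k - pos T k ≠ a := by omega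
        have h5 : (0 : ℤ) - pos T k - pos T k ≠ b := by omega
        have h6 : (0 : ℤ) - pos T k - pos T k - 1 ≠ a := by omega
        have h7 : (0 : ℤ) - pos T k - pos T k - 1 ≠ b := by omega
        simp only [State.mem_setReg, State.mem_setMem, if_neg h4, if_neg h5, if_neg h6, if_neg h7,
          Function.update_of_ne hkj, hmem]
        exact hst k
  · rw [hs₁.reg_one] at h
    have hres := hres.resolve_right fun ⟨j, _, _, _, h', _⟩ => by
      have := one_le_pos T j
      omega
    refine .const (.block_nil ⟨⟨?_, ?_, ?_, ?_, ?_⟩, by simp [hreg], .inl ⟨by simp, ?_, hres.2⟩⟩)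
    · simp [hs₁.reg_one]
    · simp [hs₁.reg_two]
    · simp [hs₁.reg_three]
    · simp [hs₁.reg_seven]
    · exact hs₁.mem
    · intro k
      simp only [State.mem_setReg, hmem]
      exact hst k

theorem one_le_address_iff (o : Option (Fin T.length)) : 1 ≤ address T o ↔ ∃ i, o = some i := by
  cases o with
  | none => simp [address]
  | some i => have := one_le_pos T i; simp [address]; omega

/-- The sum of the prices is the potential that limits the number of purchases. -/
theorem Auction.sum_le {D : Set (Fin T.length)} (h : Auction (Precedes T) own price D) :
    ∑ j, price j ≤ T.length * (T.length + 1) := by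
  have := Finset.sum_le_card_nsmul Finset.univ price _ fun j _ => h.le j
  simpa using this

/-- One trip bids, and then those that lose what they owned. -/
theorem runs_bids {s : State} {m : ℕ} (hm : m < T.length) (hs : Ready T s)
    (hst : Stored T own price s) (h5 : s.reg 5 = pos T m)
    (ha : Auction (Precedes T) own price {i | i.val < m})
    (hnew : ∀ j i, own j = some i → i.val < m) :
    Runs (.whileLe 1 5 bidProg) s (((encodeTrips T).length * (encodeTrips T).length + 1) *
      (bidTime (encodeTrips T).length + 1) + 1) fun s' => Ready T s' ∧ s'.reg 4 = s.reg 4 ∧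
        ∃ own' price', Stored T own' price' s' ∧
          Auction (Precedes T) own' price' {i | i.val < m + 1} ∧
          ∀ j i, own' j = some i → i.val < m + 1 := by
  -- The current bidder `cur` is the only one of the first `m + 1` trips that may be unsettled. The
  -- measure `k` is what the prices can still rise, plus 1 while somebody bids; the extra 1 makes
  -- giving up decrease it too.
  refine Runs.whileLe (fun k s' => Ready T s' ∧ s'.reg 4 = s.reg 4 ∧
    ∃ own price, Stored T own price s' ∧ ∃ cur, s'.reg 5 = address T cur ∧
      Auction (Precedes T) own price {i | i.val < m + 1 ∧ cur ≠ some i} ∧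
      (∀ i, cur = some i → i.val < m + 1 ∧ ∀ j, own j ≠ some i) ∧
      (∀ j i, own j = some i → i.val < m + 1) ∧
      T.length * (T.length + 1) + (if cur = none then 0 else 1) = ∑ j, price j + k) _ ?_ ?_
    (k := T.length * (T.length + 1) - ∑ j, price j + 1) ?_ ?_
  · rintro k s₁ ⟨hs₁, h4, own, price, hst, cur, h5, ha, hcur, hown, hk⟩ hle
    rw [hs₁.reg_one, h5, one_le_address_iff] at hle
    obtain ⟨i, rfl⟩ := hle
    refine (runs_bidProg hs₁ hst i h5).mono le_rfl ?_
    rintro s₂ ⟨hs₂, h4₂, ⟨h5₂, hst₂, hno⟩ | ⟨j, hj1, hj2, hj3, h5₂, hst₂⟩⟩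
    · refine ⟨k - 1, ?_, hs₂, h4₂.trans h4, own, price, hst₂, none, h5₂, ?_, by simp, hown, ?_⟩
      · have := ha.sum_le
        simp at hk; omega
      · refine (ha.giveUp i (by simpa using hno)).mono ?_
        rintro i' ⟨hi', -⟩
        by_cases hii : i' = i
        · exact .inl hii
        · exact .inr ⟨hi', by simpa using Ne.symm hii⟩
      · have := ha.sum_le
        simp at hk ⊢; omega
    · have hnew := (ha.bid i j (hcur i rfl).2 hj1 (by simpa using hj2) hj3)
      have hsum : ∑ l, Function.update price j (price j + 1) l = ∑ l, price l + 1 := by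
        rw [Finset.sum_update_of_mem (Finset.mem_univ j),
          ← Finset.add_sum_erase _ _ (Finset.mem_univ j), Finset.sdiff_singleton_eq_erase]
        omega
      have hle := hnew.sum_le
      have hji : own j ≠ some i := (hcur i rfl).2 j
      -- By `hle` the sum after the purchase is still within its bound, so the subtraction does not
      -- truncate.
      refine ⟨T.length * (T.length + 1) + (if own j = none then 0 else 1) - (∑ l, price l + 1), ?_,
        hs₂, h4₂.trans h4, _, _, hst₂, own j, h5₂, hnew.mono ?_, ?_, ?_, ?_⟩
      · simp at hk
        split_ifs <;> omega
      · rintro i' ⟨hi', hne⟩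
        refine ⟨?_, hne⟩
        by_cases hii : i' = i
        · exact .inl hii
        · exact .inr ⟨hi', by simpa using Ne.symm hii⟩
      · intro i' hi'
        refine ⟨hown j i' hi', fun l => ?_⟩
        by_cases hl : l = j
        · subst hl
          rw [Function.update_self, ← hi']
          exact hji.symm
        · rw [Function.update_of_ne hl]
          -- The evicted owner had owned only `j`, so it now owns nothing.
          exact fun h => hl (ha.inj _ _ _ h hi')
      · intro l i' hl
        by_cases hlj : l = j
        · subst hlj
          rw [Function.update_self] at hl
          cases hl
          exact (hcur i rfl).1
        · rw [Function.update_of_ne hlj] at hl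
          exact hown l i' hl
      · rw [hsum]
        omega
  · rintro k s₁ ⟨hs₁, h4, own, price, hst, cur, h5, ha, hcur, hown, hk⟩ hlt
    have hnone : cur = none := by
      cases cur with
      | none => rfl
      | some i =>
        have := (one_le_address_iff (some i)).2 ⟨i, rfl⟩
        rw [hs₁.reg_one, h5] at hlt
        omega
    subst hnone
    exact ⟨hs₁, h4, own, price, hst, ha.mono fun i hi => ⟨hi, by simp⟩, hown⟩
  · have := length_le T
    have : T.length * (T.length + 1) ≤ (encodeTrips T).length * (encodeTrips T).length :=
      Nat.mul_le_mul (by omega) (by omega)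
    omega
  · refine ⟨hs, rfl, own, price, hst, some ⟨m, hm⟩, h5, ha.mono ?_, ?_, ?_, ?_⟩
    · rintro i ⟨hi, hne⟩
      have : i.val ≠ m := fun h => hne (congrArg some (Fin.ext h.symm))
      change i.val < m
      omega
    · rintro i hi
      cases hi
      exact ⟨by simp, fun j hj => absurd (hnew _ _ hj) (by simp)⟩
    · intro j i hj
      have := hnew j i hj
      omega
    · have := ha.sum_le
      simp; omega

/-- Zeros in the negative cells already encode that nothing is owned and all prices are 0. Each
trip's turn is charged with the bound for the whole auction, which is crude but polynomial. -/
theorem runs_auctionProg {s : State} (hs : Ready T s) (hneg : ∀ a < 0, s.mem a = 0) :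
    Runs auctionProg s (auctionTime (encodeTrips T).length) fun s' => Ready T s' ∧
      ∃ own price, Stored T own price s' ∧ Auction (Precedes T) own price Set.univ := by
  set L := (encodeTrips T).length with hL
  refine .mono (T := (L * (((L * L + 1) * (bidTime L + 1) + 10) + 1) + 1) + 1 + 1) ?_ ?_
    fun _ h => h
  swap
  · have := Nat.mul_le_mul_left L (show ((L * L + 1) * (bidTime L + 1) + 10) + 1 ≤
      (L * L + 1) * (bidTime L + 1) + 20 by omega)
    simp only [auctionTime]
    omega
  refine .block_const <| .block_cons (T' := 1)
    (T := L * (((L * L + 1) * (bidTime L + 1) + 10) + 1) + 1) ?_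
  refine runs_forTrips (T := T) (fun m s' => Ready T s' ∧ ∃ own price, Stored T own price s' ∧
    Auction (Precedes T) own price {i | i.val < m} ∧ ∀ j i, own j = some i → i.val < m)
    _ ?_ ?_ ?_ (by simp) ?_
  · exact fun _ _ h => h.1.reg_three
  · rintro m s₁ hm ⟨hs₁, own, price, hst, ha, hown⟩ h4
    refine .mono (T := (L * L + 1) * (bidTime L + 1) + 1 + 6 + 1) ?_ (by omega) fun _ h => h
    refine .block_add fun v e => ?_
    simp [h4, hs₁.reg_seven] at e
    have hs₁' : Ready T (s₁.setReg 5 v) :=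
      ⟨by simp [hs₁.reg_one], by simp [hs₁.reg_two], by simp [hs₁.reg_three],
        by simp [hs₁.reg_seven], hs₁.mem⟩
    refine Runs.block_cons (T := (L * L + 1) * (bidTime L + 1) + 1) (T' := 6)
      ((runs_bids hm hs₁' hst (by simp [e]) ha hown).mono le_rfl ?_)
    rintro s₂ ⟨hs₂, h4₂, own', price', hst₂, ha₂, hown₂⟩
    simp at h4₂
    refine runs_nextProg (l := []) (t := 1) hm hs₂.reg_one (hs₂.mem _ (by positivity))
      (h4₂.trans h4) (by norm_num) (by norm_num)
      fun s₃ hmem₃ hreg₃ h4₃ => .block_nil ⟨h4₃, ?_, own', price', ?_, ha₂, hown₂⟩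
    · exact ⟨by rw [hreg₃ _ (by norm_num) (by norm_num), hs₂.reg_one],
        by rw [hreg₃ _ (by norm_num) (by norm_num), hs₂.reg_two],
        by rw [hreg₃ _ (by norm_num) (by norm_num), hs₂.reg_three],
        by rw [hreg₃ _ (by norm_num) (by norm_num), hs₂.reg_seven],
        by rw [hmem₃]; exact hs₂.mem⟩
    · intro j; rw [hmem₃]; exact hst₂ j
  · rintro s' ⟨hs', own, price, hst, ha, -⟩
    exact .block_nil ⟨hs', own, price, hst, ha.mono fun i _ => i.2⟩
  · refine ⟨⟨by simp [hs.reg_one], by simp [hs.reg_two], by simp [hs.reg_three],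
        by simp [hs.reg_seven], hs.mem⟩, fun _ => none, fun _ => 0, fun j => ?_,
        Auction.initial.mono (by simp), by simp⟩
    have := one_le_pos T j
    simp only [State.mem_setReg]
    exact ⟨hneg _ (by omega), hneg _ (by omega)⟩

/-! ### Labelling and the final assembly -/

/-- The contents of registers and memory after `m` trips have been labelled. -/
structure Labelled (T : List Trip) (s₀ : State) (label : Fin T.length → ℤ) (m : ℕ) (s : State) :
    Prop where
  reg_one : s.reg 1 = 1
  reg_three : s.reg 3 = (encodeTrips T).length - 1
  reg_six : s.reg 6 = m
  reg_seven : s.reg 7 = 0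
  mem_input : ∀ a : ℤ, m ≤ a → s.mem a = word T a
  mem_neg : ∀ a < 0, s.mem a = s₀.mem a
  mem_label : ∀ k : Fin T.length, k.val < m → s.mem k.val = label k

/-- Follow the owners to the beginning of a chain. -/
theorem runs_findRoot {s : State} (hst : Stored T own price s)
    (h : ∀ j i, own j = some i → Precedes T i j) (h1 : s.reg 1 = 1) (h7 : s.reg 7 = 0)
    {j : Fin T.length} (h5 : s.reg 5 = pos T j) (h13 : s.reg 13 = address T (own j)) :
    Runs (.whileLe 1 13 (block [.add 5 13 7, .sub 14 7 5, .sub 14 14 5, .load 13 14])) s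
      ((encodeTrips T).length * 6 + 1) fun s' => s'.mem = s.mem ∧
        (∀ x < 10, x ≠ 5 → s'.reg x = s.reg x) ∧ s'.reg 5 = pos T (root own h j).val := by
  -- The measure is the height of the current trip `c`: an owner precedes what it owns, so each step
  -- descends, and `c` keeps the root of `j`.
  refine Runs.whileLe (fun k s' => s'.mem = s.mem ∧ (∀ x < 10, x ≠ 5 → s'.reg x = s.reg x) ∧
    ∃ c, height (Precedes T) c = k ∧ root own h c = root own h j ∧ s'.reg 5 = pos T c ∧
      s'.reg 13 = address T (own c)) 5 ?_ ?_ (k := height (Precedes T) j) ?_ ?_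
  · rintro k s₁ ⟨hmem, hreg, c, hk, hroot, h5, h13⟩ hle
    rw [hreg 1 (by norm_num) (by norm_num), h1, h13, one_le_address_iff] at hle
    obtain ⟨i, hi⟩ := hle
    rw [hi] at h13
    refine .block_add fun v₁ e₁ => .block_sub fun v₂ e₂ => .block_sub fun v₃ e₃ =>
      .block_load fun v₄ e₄ => .block_nil ⟨_, ?_, ?_, ?_, i, rfl, ?_, ?_, ?_⟩
    · exact hk ▸ height_lt (h c i hi)
    · simp [hmem]
    · intro x hx hx5
      simp [hx5, show x ≠ 13 by omega, show x ≠ 14 by omega, hreg x hx hx5]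
    · rw [← hroot, root_of_some hi]
    · simp [h13, hreg, h7] at e₁
      simp [e₁, address]
    · simp [h13, hreg, h7] at e₁ e₂ e₃ e₄
      have hv₃ : v₃ = 0 - pos T i - pos T i := by rw [e₃, e₂, e₁]; simp [address]
      simp only [State.reg_setReg, reduceIte]
      rw [e₄, hmem, hv₃, (hst i).1]
  · rintro k s₁ ⟨hmem, hreg, c, hk, hroot, h5, h13⟩ hlt
    refine ⟨hmem, hreg, ?_⟩
    rw [hreg 1 (by norm_num) (by norm_num), h1, h13, ← not_le, one_le_address_iff] at hlt
    have hc : own c = none := by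
      cases hc : own c with
      | none => rfl
      | some i => exact absurd ⟨i, hc⟩ hlt
    rw [h5, ← hroot, root_of_none hc]
  · have := height_le (r := Precedes T) j
    have := length_le T
    simp at *; omega
  · exact ⟨rfl, fun _ _ _ => rfl, j, rfl, rfl, h5, h13⟩

theorem runs_labelProg {s : State} (hs : Ready T s) (hst : Stored T own price s)
    (h : ∀ j i, own j = some i → Precedes T i j) :
    Runs labelProg s (labelTime (encodeTrips T).length) fun s' => s'.reg 0 = T.length ∧
      ∀ k : Fin T.length, s'.mem k.val = pos T (root own h k).val := by
  set L := (encodeTrips T).length with hL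
  refine .mono (T := (L * (L * 10 + 29 + 1) + 1) + 2 + 1 + 1) ?_
    (by simp only [labelTime, add_assoc, Nat.reduceAdd]; omega) fun _ h => h
  refine .block_const <| .block_const <| .block_cons (T' := 2) (T := L * (L * 10 + 29 + 1) + 1) ?_
  refine runs_forTrips (T := T) (Labelled T s fun k => pos T (root own h k).val) _ ?_ ?_ ?_
    (by simp) ?_
  · exact fun _ _ h => h.reg_three
  · rintro m s₁ hm hs₁ h4
    refine .mono (T := (L * 6 + 1) + 9 + 1 + 1 + 1 + 1) ?_ (by omega) fun _ h => h
    refine .block_add fun v₁ e₁ => .block_sub fun v₂ e₂ => .block_sub fun v₃ e₃ =>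
      .block_load fun v₄ e₄ => ?_
    simp [h4, hs₁.reg_seven] at e₁ e₂ e₃ e₄
    have hst' : Stored T own price s₁ := fun j => by
      have := one_le_pos T j
      rw [hs₁.mem_neg _ (by omega), hs₁.mem_neg _ (by omega)]
      exact hst j
    have hv₄ : v₄ = address T (own ⟨m, hm⟩) := by
      rw [e₄, ← (hst' ⟨m, hm⟩).1, e₃, e₂, e₁]; simp
    refine Runs.block_cons (T := L * 6 + 1) (T' := 9)
      ((runs_findRoot (j := ⟨m, hm⟩) (price := price) ?_ h (by simp [hs₁.reg_one])
        (by simp [hs₁.reg_seven]) (by simp [e₁]) (by simp [hv₄])).mono le_rfl ?_)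
    · intro j; exact hst' j
    rintro s₂ ⟨hmem₂, hreg₂, h5⟩
    have hreg₂' : ∀ x < 10, x ≠ 5 → s₂.reg x = s₁.reg x := fun x hx hx5 => by
      rw [hreg₂ x hx hx5]; simp; split_ifs <;> omega
    simp only [State.mem_setReg] at hmem₂
    refine runs_nextProg (t := 4) hm ((hreg₂' 1 (by norm_num) (by norm_num)).trans hs₁.reg_one) ?_
      ((hreg₂' 4 (by norm_num) (by norm_num)).trans h4) (by norm_num) (by norm_num) ?_
    -- Only cells below `m` have been overwritten, and trip `m` starts beyond them.
    · rw [hmem₂, hs₁.mem_input _ (by have := lt_pos (T := T) hm.le; omega)]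
    intro s₃ hmem₃ hreg₃ h4₃
    have hreg : ∀ x < 10, x ≠ 4 → x ≠ 5 → s₃.reg x = s₁.reg x := fun x hx hx4 hx5 =>
      (hreg₃ x hx4 (by omega)).trans (hreg₂' x hx hx5)
    have hmem : s₃.mem = s₁.mem := hmem₃.trans hmem₂
    refine .block_store fun a v ea ev => .block_add fun w ew => .block_nil ⟨by simp [h4₃], ?_⟩
    rw [hreg 6 (by norm_num) (by norm_num) (by norm_num), hs₁.reg_six] at ea
    rw [hreg₃ 5 (by norm_num) (by norm_num), h5] at ev
    simp [hreg, hs₁.reg_six, hs₁.reg_one] at ew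
    refine ⟨by simp [hreg, hs₁.reg_one], by simp [hreg, hs₁.reg_three], by simp [ew],
      by simp [hreg, hs₁.reg_seven], fun c hc => ?_, fun c hc => ?_, fun k hk => ?_⟩
    · have : c ≠ a := by push_cast at hc; omega
      simp [this, hmem, hs₁.mem_input c (by push_cast at hc; omega)]
    · have : c ≠ a := by omega
      simp [this, hmem, hs₁.mem_neg c hc]
    · by_cases hkm : k.val = m
      · obtain rfl : k = ⟨m, hm⟩ := Fin.ext hkm
        simp [ea, ev]
      · have : (k.val : ℤ) ≠ a := by omega
        simp [this, hmem, hs₁.mem_label k (by omega)]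
  · rintro s' hs'
    refine .block_add fun v e => .block_nil ⟨?_, fun k => ?_⟩
    · simp [hs'.reg_six, hs'.reg_seven] at e
      simp [e]
    · simpa using hs'.mem_label k k.2
  · exact ⟨by simp [hs.reg_one], by simp [hs.reg_three], by simp, by simp [hs.reg_seven],
      fun a ha => hs.mem a (by simpa using ha), fun a _ => rfl, fun k hk => by omega⟩

theorem runs_groupingProg (T : List Trip) :
    Runs groupingProg (State.init (encodeTrips T)) (groupingTime (encodeTrips T).length) fun s' =>
      ∃ w : List ℤ, s'.HasOutput w ∧ IsOptimalAnswer T w ∧ w.length = T.length := by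
  set L := (encodeTrips T).length with hL
  refine .mono (T := auctionTime L + (labelTime L + 1) + 1 + 1 + 1 + 1) ?_
    (by simp only [groupingTime]; omega) fun _ h => h
  refine .block_const <| .block_sub fun v₁ e₁ => .block_load fun v₂ e₂ => .block_add fun v₃ e₃ => ?_
  have h0 : (State.init (encodeTrips T)).reg 0 = L := by simp [State.init, hL]
  have h7 : (State.init (encodeTrips T)).reg 7 = 0 := by simp [State.init]
  have hmem : (State.init (encodeTrips T)).mem 0 = T.length := word_zero T
  simp [h0, h7, hmem] at e₁ e₂ e₃
  refine Runs.block_cons (T := auctionTime L) (T' := labelTime L + 1)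
    ((runs_auctionProg (T := T) ⟨?_, ?_, ?_, ?_, ?_⟩ fun a ha => ?_).mono le_rfl ?_)
  · simp
  · simp [e₂, e₃]
  · simp [e₁, hL]
  · simp [h7]
  · exact fun a _ => rfl
  · simp [State.init, not_le.2 ha]
  rintro s₁ ⟨hs₁, own, price, hst, ha⟩
  refine Runs.block_cons (T := labelTime L) (T' := 1)
    ((runs_labelProg hs₁ hst ha.rel).mono le_rfl ?_)
  rintro s₂ ⟨h0₂, hmem₂⟩
  refine .block_nil ⟨List.ofFn fun k => (pos T (root own ha.rel k).val : ℤ), ⟨by simp [h0₂], ?_⟩,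
    ha.isOptimalAnswer (by simp) (label := fun i => (pos T i : ℤ)) ?_ ?_, by simp⟩
  · intro i hi
    simpa using hmem₂ ⟨i, by simpa using hi⟩
  · intro i j hij
    exact pos_injective (by simpa using hij)
  · intro i
    simp

end Timetable

theorem theorem1 :
    RAM.PolyTimeSolvable Timetable.encodeTrips Timetable.IsOptimalAnswer := by
  open Timetable in
  -- The time bound, read over `Polynomial ℕ`, is itself the polynomial. The additional `X` pays for
  -- the delivery of the output, which has fewer words than the input.
  refine ⟨groupingProg, groupingTime Polynomial.X + Polynomial.X, fun T => ?_⟩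
  obtain ⟨t, s, hexec, ht, w, hout, hans, hlen⟩ := runs_groupingProg T
  refine ⟨t, s, w, hexec, hout, hans, ?_⟩
  have hT := length_le T
  have hsize := RAM.length_le_bitSize (encodeTrips T)
  -- The running time was bounded in terms of the number of words; monotonicity passes to the number
  -- of bits.
  have hmono : Monotone (groupingTime : ℕ → ℕ) := by
    intro x y hxy
    simp only [groupingTime, auctionTime, labelTime, bidTime, scanTime, precedesTime, compareTime]
    gcongr
  have heval : ∀ x : ℕ, (groupingTime (Polynomial.X : Polynomial ℕ)).eval x = groupingTime x := by
    intro x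
    simp [groupingTime, auctionTime, labelTime, bidTime, scanTime, precedesTime, compareTime]
  rw [Polynomial.eval_add, heval, Polynomial.eval_X]
  have := hmono hsize
  omega
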